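/- Let $\lambda$ denote Lebesgue measure on $[0,1]$, and let $\mathcal W$ be the set of bounded symmetric functions $W:[0,1]^2\to\mathbb R$ that are measurable with respect to the Lebesgue sets of $[0,1]^2$. Graphs are finite and loopless; a simple graph has no multiple edges, while a multigraph may have them. For a graph or multigraph $F$ with vertex set $\{1,\dots,n\}$ and $W\in\mathcal W$ put $$t(F,W)=\int_{[0,1]^n}\ \prod_{ij\in E(F)}W(x_i,x_j)\,dx_1\cdots dx_n,$$ where each edge is taken with its multiplicity. A map $\varphi:[0,1]\to[0,1]$ is measure preserving if, for every Lebesgue set $A\subseteq[0,1]$, the set $\varphi^{-1}(A)$ is a Lebesgue set with $\lambda(\varphi^{-1}(A))=\lambda(A)$. Write $W^{\varphi}(x,y)=W(\varphi(x),\varphi(y))$. For any two functions $W,W'\in\mathcal W$ the following are equivalent. (a) $t(F,W')=t(F,W)$ for every simple graph $F$. (b) $t(F,W')=t(F,W)$ for every multigraph $F$. (c) There exist a function $U\in\mathcal W$ and two measure preserving maps $\varphi,\psi:[0,1]\to[0,1]$ such that $W=U^{\varphi}$ and $W'=U^{\psi}$ almost everywhere on $[0,1]^2$. (d) There exist two measure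 preserving maps $\varphi,\psi:[0,1]\to[0,1]$ such that $(W')^{\varphi}=W^{\psi}$ almost everywhere on $[0,1]^2$. (e) There exists a probability measure $\gamma$ on $[0,1]\times[0,1]$ such that each marginal of $\gamma$ is $\lambda$ and, if $(X,X')$ and $(Y,Y')$ are two independent samples from $\gamma$, then $W(X,Y)=W'(X',Y')$ with probability $1$. -/

import Mathlib

open MeasureTheory
open scoped unitInterval

noncomputable section

/-- The class of bounded symmetric functions on the unit square that are measurable with respect to
the Lebesgue sets, i.e. the completion of the Borel sets under the product measure
(`NullMeasurable`). These are genuine functions, not classes modulo null sets. -/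
structure SymmKernel where
  toFun : I → I → ℝ
  symm' : ∀ x y, toFun x y = toFun y x
  bounded' : ∃ C : ℝ, ∀ x y, |toFun x y| ≤ C
  measurable' : NullMeasurable (fun p : I × I => toFun p.1 p.2) volume

instance : CoeFun SymmKernel (fun _ => I → I → ℝ) := ⟨SymmKernel.toFun⟩

/-- The pull-back `(x, y) ↦ W (φ x) (φ y)` of a two-variable function along `φ`. -/
def pullback (W : I → I → ℝ) (φ : I → I) : I → I → ℝ := fun x y => W (φ x) (φ y)

/-- Two functions on the unit square are equal almost everywhere. -/
def AEEqSquare (f g : I → I → ℝ) : Prop :=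
  ∀ᵐ p ∂(volume : Measure (I × I)), f p.1 p.2 = g p.1 p.2

/-- A measure preserving self-map of the Lebesgue space `[0,1]`, the completion of the Borel
probability space `[0,1]`: preimages of Lebesgue sets are Lebesgue sets of the same measure. -/
def LebesguePreserving (φ : I → I) : Prop :=
  MeasurePreserving (α := NullMeasurableSpace I volume) (β := NullMeasurableSpace I volume) φ
    (volume : Measure I).completion (volume : Measure I).completion

/-- A multigraph on the vertex set `V`: a finite multiset of unordered pairs; parallel edges
are allowed, loops are not. -/
structure Multigraph (V : Type) where
  edges : Multiset (Sym2 V)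
  loopless : ∀ e ∈ edges, ¬ e.IsDiag

/-- The value `W (x i) (x j)` at the unordered pair `{i, j}`. -/
def SymmKernel.onEdge (W : SymmKernel) {V : Type} (x : V → I) : Sym2 V → ℝ :=
  Sym2.lift ⟨fun i j => W (x i) (x j), fun i j => W.symm' (x i) (x j)⟩

open Classical in
/-- The density of a finite simple graph `F` in `W`. -/
def simpleDensity {V : Type} [Fintype V] (F : SimpleGraph V) (W : SymmKernel) : ℝ :=
  ∫ x : V → I, ∏ e ∈ F.edgeFinset, W.onEdge x e

/-- The density of a finite multigraph `F` in `W`; each edge counts with its multiplicity. -/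
def multiDensity {V : Type} [Fintype V] (F : Multigraph V) (W : SymmKernel) : ℝ :=
  ∫ x : V → I, (F.edges.map (W.onEdge x)).prod

end

/-! Read a kernel with values in `[-1, 1]` as a random signed graph: draw independent uniform points
`x i` and then independent signs with means `W (x i) (x j)`. The probability of a sign pattern is a
linear combination of simple graph densities, so if these agree for `W` and `W'`, then both kernels
produce the same random signs. Hence there are points `x` for `W` and `y` for `W'` which are typical
together with one and the same sign pattern. A four-cycle count shows that the signs are close in
cut norm to the sampled matrices `W (x i) (x j)` and `W' (y i) (y j)`, which are thus close to each
other, and a limit point `γ` of the empirical measures of the pairs `(x i, y i)` couples `W` with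
`W'`.

Given such a coupling of random points `X` and `Y`, integrate the sections of `W` at `X` and of `W'`
at `Y` over countably many events in `X`, enough to determine a section of `W` almost everywhere.
The two families of integrals are the same random sequence, so both kernels factor through it by one
common kernel. Encoding its values as points of `[0, 1]` and moving their law to Lebesgue measure by
a quantile transform gives the common factor `U`. -/

open scoped ENNReal BigOperators BoundedContinuousFunction
open Filter Topology

theorem lebesguePreserving_of_measurePreserving {φ : I → I}
    (h : MeasurePreserving φ volume volume) : LebesguePreserving φ := by
  let φ' : NullMeasurableSpace I volume → NullMeasurableSpace I volume := φ
  have hφ' : Measurable φ' := fun s hs =>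
    NullMeasurableSet.preimage hs h.quasiMeasurePreserving
  refine ⟨hφ', Measure.ext fun s hs => (Measure.map_apply hφ' hs).trans ?_⟩
  exact (Measure.completion_apply _ _).trans
    ((h.measure_preimage hs).trans (Measure.completion_apply _ _).symm)

theorem LebesguePreserving.exists_measurePreserving {φ : I → I} (h : LebesguePreserving φ) :
    ∃ φ' : I → I, MeasurePreserving φ' volume volume ∧ φ =ᵐ[volume] φ' := by
  have hφ : AEMeasurable φ (volume : Measure I) :=
    NullMeasurable.aemeasurable fun s hs => h.measurable hs.nullMeasurableSet
  refine ⟨hφ.mk φ, ⟨hφ.measurable_mk, Measure.ext fun s hs => ?_⟩, hφ.ae_eq_mk⟩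
  have hpre := MeasurePreserving.measure_preimage h (s := s)
    (MeasurableSet.nullMeasurableSet hs.nullMeasurableSet)
  rw [Measure.map_apply hφ.measurable_mk hs, measure_congr (hφ.ae_eq_mk.symm.preimage s)]
  exact (Measure.completion_apply _ _).symm.trans (hpre.trans (Measure.completion_apply _ _))

theorem measurePreserving_eval_pair {V Ω : Type*} [Fintype V] [MeasurableSpace Ω]
    (ν : Measure Ω) [IsProbabilityMeasure ν] {i j : V} (hij : i ≠ j) :
    MeasurePreserving (fun z : V → Ω => (z i, z j)) (Measure.pi fun _ => ν) (ν.prod ν) := by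
  have indep := (ProbabilityTheory.iIndepFun_pi (μ := fun _ : V => ν) (X := fun _ => id)
    (fun _ => aemeasurable_id)).indepFun hij
  have law (k : V) : Measure.map (fun z : V → Ω => z k) (Measure.pi fun _ => ν) = ν :=
    (measurePreserving_eval (fun _ : V => ν) k).map_eq
  refine ⟨by fun_prop, ?_⟩
  simpa only [id, law] using (ProbabilityTheory.indepFun_iff_map_prod_eq_prod_map_map
    (measurable_pi_apply i).aemeasurable (measurable_pi_apply j).aemeasurable).1 indep

/-- A coupling of the kernels `W` and `W'`: random points `X` and `Y` of `[0,1]`, each uniformly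
distributed, such that two independent copies of the pair `(X, Y)` give `W` and `W'` the same value
almost surely. The probability space is left free so that each of the three relations between
`W` and `W'` in the theorem is an instance. -/
structure KernelCoupling {Ω : Type*} [MeasurableSpace Ω] (ν : Measure Ω) (X Y : Ω → I)
    (W W' : I → I → ℝ) : Prop where
  left : MeasurePreserving X ν volume
  right : MeasurePreserving Y ν volume
  ae_eq : ∀ᵐ p ∂ν.prod ν, W (X p.1) (X p.2) = W' (Y p.1) (Y p.2)

namespace KernelCoupling

variable {Ω : Type*} [MeasurableSpace Ω] {ν : Measure Ω} {X Y : Ω → I}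
  {W W' : I → I → ℝ}

theorem comp {Ω' : Type*} [MeasurableSpace Ω'] {ν' : Measure Ω'} [SFinite ν']
    {ρ : Ω' → Ω} (h : KernelCoupling ν X Y W W') (hρ : MeasurePreserving ρ ν' ν) :
    KernelCoupling ν' (X ∘ ρ) (Y ∘ ρ) W W' where
  left := h.left.comp hρ
  right := h.right.comp hρ
  ae_eq := (hρ.prod hρ).quasiMeasurePreserving.ae h.ae_eq

theorem congr_kernels [SFinite ν] {V V' : I → I → ℝ} (h : KernelCoupling ν X Y W W')
    (hV : AEEqSquare W V) (hV' : AEEqSquare W' V') : KernelCoupling ν X Y V V' where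
  left := h.left
  right := h.right
  ae_eq := by
    filter_upwards [h.ae_eq, (h.left.prod h.left).quasiMeasurePreserving.ae hV,
      (h.right.prod h.right).quasiMeasurePreserving.ae hV'] with p hp hVp hVp'
    exact hVp.symm.trans (hp.trans hVp')

theorem of_aeEqSquare_pullback {W W' : I → I → ℝ} {φ ψ : I → I} (hφ : LebesguePreserving φ)
    (hψ : LebesguePreserving ψ) (h : AEEqSquare (pullback W φ) (pullback W' ψ)) :
    ∃ φ' ψ' : I → I, KernelCoupling volume φ' ψ' W W' := by
  obtain ⟨φ', hφ', hφφ'⟩ := hφ.exists_measurePreserving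
  obtain ⟨ψ', hψ', hψψ'⟩ := hψ.exists_measurePreserving
  refine ⟨φ', ψ', hφ', hψ', ?_⟩
  filter_upwards [h, Measure.quasiMeasurePreserving_fst.ae hφφ',
    Measure.quasiMeasurePreserving_snd.ae hφφ', Measure.quasiMeasurePreserving_fst.ae hψψ',
    Measure.quasiMeasurePreserving_snd.ae hψψ'] with p hp hφ₁ hφ₂ hψ₁ hψ₂
  rw [← hφ₁, ← hφ₂, ← hψ₁, ← hψ₂]
  exact hp

end KernelCoupling

theorem SymmKernel.aemeasurable_onEdge (W : SymmKernel) {V : Type} [Fintype V] {e : Sym2 V}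
    (he : ¬ e.IsDiag) : AEMeasurable (fun x : V → I => W.onEdge x e) volume := by
  induction e with
  | h i j =>
    have hij : i ≠ j := he
    exact W.measurable'.aemeasurable.comp_quasiMeasurePreserving
      (measurePreserving_eval_pair volume hij).quasiMeasurePreserving

theorem SymmKernel.aemeasurable_prod_onEdge (W : SymmKernel) {V : Type} [Fintype V]
    (F : Multigraph V) :
    AEMeasurable (fun x : V → I => (F.edges.map (W.onEdge x)).prod) volume := by
  obtain ⟨s, hs⟩ := F
  induction s using Multiset.induction with
  | empty => simp
  | cons e s ih =>
    simp only [Multiset.map_cons, Multiset.prod_cons]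
    exact (W.aemeasurable_onEdge (hs e (Multiset.mem_cons_self e s))).mul
      (ih fun e he => hs e (Multiset.mem_cons_of_mem he))

theorem multiDensity_eq_integral_comp {Ω : Type*} {V : Type} [Fintype V] [MeasurableSpace Ω]
    {ν : Measure Ω} {X : Ω → I} (hX : MeasurePreserving X ν volume) (F : Multigraph V)
    (W : SymmKernel) : multiDensity F W =
      ∫ z : V → Ω, (F.edges.map (W.onEdge fun i => X (z i))).prod ∂Measure.pi fun _ => ν := by
  have hpi : MeasurePreserving (fun (z : V → Ω) i => X (z i)) (Measure.pi fun _ => ν) volume :=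
    measurePreserving_pi _ _ fun _ => hX
  rw [multiDensity, ← hpi.map_eq, integral_map hpi.aemeasurable]
  rw [hpi.map_eq]
  exact (W.aemeasurable_prod_onEdge F).aestronglyMeasurable

theorem KernelCoupling.multiDensity_eq {Ω : Type*} {V : Type} [Fintype V] [MeasurableSpace Ω]
    {ν : Measure Ω} [IsProbabilityMeasure ν] {X Y : Ω → I} {W W' : SymmKernel}
    (h : KernelCoupling ν X Y W W') (F : Multigraph V) :
    multiDensity F W = multiDensity F W' := by
  rw [multiDensity_eq_integral_comp h.left, multiDensity_eq_integral_comp h.right]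
  have edges_eq : ∀ᵐ z ∂Measure.pi fun _ : V => ν, ∀ e : Sym2 V, e ∈ F.edges →
      W.onEdge (fun i => X (z i)) e = W'.onEdge (fun i => Y (z i)) e := by
    refine ae_all_iff.2 fun e => eventually_imp_distrib_left.2 fun he => ?_
    have hne := F.loopless e he
    induction e with
    | h i j =>
      have hij : i ≠ j := hne
      exact (measurePreserving_eval_pair ν hij).quasiMeasurePreserving.ae h.ae_eq
  refine integral_congr_ae (edges_eq.mono fun z hz => ?_)
  exact congrArg Multiset.prod (Multiset.map_congr rfl hz)

open Classical in
/-- A simple graph regarded as a multigraph, which makes simple densities a case of multigraph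
densities. -/
noncomputable def Multigraph.ofSimpleGraph {V : Type} [Fintype V] (F : SimpleGraph V) :
    Multigraph V where
  edges := F.edgeFinset.val
  loopless e he := F.not_isDiag_of_mem_edgeSet (by simpa using he)

theorem multiDensity_ofSimpleGraph {V : Type} [Fintype V] (F : SimpleGraph V) (W : SymmKernel) :
    multiDensity (Multigraph.ofSimpleGraph F) W = simpleDensity F W :=
  rfl

theorem SymmKernel.exists_borel (W : SymmKernel) {C : ℝ} (hC : ∀ x y, |W x y| ≤ C) :
    ∃ V : SymmKernel, Measurable (fun p : I × I => V p.1 p.2) ∧ (∀ x y, |V x y| ≤ C) ∧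
      AEEqSquare W V := by
  have hW : AEMeasurable (fun p : I × I => W p.1 p.2) volume := W.measurable'.aemeasurable
  let g := hW.mk _
  let f : I → I → ℝ := fun x y => max (-C) (min C ((g (x, y) + g (y, x)) / 2))
  have hC₀ : 0 ≤ C := (abs_nonneg _).trans (hC 0 0)
  have measurable_f : Measurable fun p : I × I => f p.1 p.2 :=
    measurable_const.max <| measurable_const.min <|
      (hW.measurable_mk.add (hW.measurable_mk.comp measurable_swap)).div_const 2
  have abs_f_le (x y : I) : |f x y| ≤ C :=
    abs_le.2 ⟨le_max_left _ _, max_le (by linarith) (min_le_left _ _)⟩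
  refine ⟨⟨f, fun x y => by simp only [f, add_comm], ⟨C, abs_f_le⟩, measurable_f.nullMeasurable⟩,
    measurable_f, abs_f_le, ?_⟩
  have swap : ∀ᵐ p ∂(volume : Measure (I × I)), W p.2 p.1 = g p.swap :=
    Measure.measurePreserving_swap.quasiMeasurePreserving.ae hW.ae_eq_mk
  change ∀ᵐ p ∂(volume : Measure (I × I)), W p.1 p.2 = f p.1 p.2
  filter_upwards [hW.ae_eq_mk, swap] with p hp hp'
  have hb := abs_le.1 (hC p.1 p.2)
  have hfp : f p.1 p.2 = max (-C) (min C ((W p.1 p.2 + W p.1 p.2) / 2)) := by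
    rw [W.symm' p.2 p.1] at hp'
    nth_rw 1 [hp, hp']
    rfl
  rw [hfp, add_self_div_two, min_eq_right hb.2, max_eq_right hb.1]

section Signs

variable {E : Type*} [Fintype E]

/-- The probability of the sign pattern `ε` when the signs are independent with means `v`. -/
noncomputable def signWeight (v : E → ℝ) (ε : E → ℤˣ) : ℝ := ∏ e, (1 + ((ε e : ℤ) : ℝ) * v e) / 2

theorem signWeight_nonneg {v : E → ℝ} (hv : ∀ e, |v e| ≤ 1) (ε : E → ℤˣ) :
    0 ≤ signWeight v ε := by
  refine Finset.prod_nonneg fun e _ => ?_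
  have h := abs_le.1 (hv e)
  rcases Int.units_eq_one_or (ε e) with hε | hε <;> norm_num [hε] <;> linarith

variable [DecidableEq E]

theorem sum_signWeight (v : E → ℝ) : ∑ ε, signWeight v ε = 1 := by
  unfold signWeight
  rw [← Fintype.prod_sum fun e (s : ℤˣ) => (1 + ((s : ℤ) : ℝ) * v e) / 2]
  refine Finset.prod_eq_one fun e _ => ?_
  rw [UnitsInt.univ, Finset.sum_pair (by decide)]
  push_cast
  ring

theorem sum_signWeight_mul_eq_zero (v : E → ℝ) (e : E) (g : (E → ℤˣ) → ℝ)
    (hg : ∀ ε s, g (Function.update ε e s) = g ε) :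
    ∑ ε, signWeight v ε * ((ε e - v e) * g ε) = 0 := by
  let flip (ε : E → ℤˣ) : E → ℤˣ := Function.update ε e (-ε e)
  have flip_flip : Function.Involutive flip := fun ε => by simp [flip]
  have split (ε : E → ℤˣ) : signWeight v ε =
      (1 + ε e * v e) / 2 * ∏ e' ∈ Finset.univ.erase e, (1 + ε e' * v e') / 2 :=
    (Finset.mul_prod_erase _ _ (Finset.mem_univ e)).symm
  have prod_flip (ε : E → ℤˣ) : ∏ e' ∈ Finset.univ.erase e, (1 + (flip ε e') * v e') / 2 =
      ∏ e' ∈ Finset.univ.erase e, (1 + ε e' * v e') / 2 :=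
    Finset.prod_congr rfl fun e' he' => by
      simp only [flip, Function.update_of_ne (Finset.ne_of_mem_erase he')]
  have neg (ε : E → ℤˣ) : signWeight v (flip ε) * ((flip ε e - v e) * g (flip ε)) =
      -(signWeight v ε * ((ε e - v e) * g ε)) := by
    rw [split, split ε, prod_flip, hg, show flip ε e = -ε e from Function.update_self ..]
    rcases Int.units_eq_one_or (ε e) with hε | hε <;> simp only [hε] <;> push_cast <;> ring
  refine self_eq_neg.1 ?_
  calc ∑ ε, signWeight v ε * ((ε e - v e) * g ε)
      = ∑ ε, signWeight v (flip ε) * ((flip ε e - v e) * g (flip ε)) :=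
        (Equiv.sum_comp flip_flip.toPerm _).symm
    _ = -∑ ε, signWeight v ε * ((ε e - v e) * g ε) := by
        simp only [neg, Finset.sum_neg_distrib]

end Signs

section FourCycle

variable {ι κ : Type*} [Fintype ι] [Fintype κ]

/-- The homomorphism density of the four-cycle `i j i' k` in the matrix `d`. It controls the cut
norm of `d` (`expect_bilinear_pow_four_le`), and is small when `d` consists of independent centred
entries. -/
noncomputable def fourCycleDensity (d : ι → κ → ℝ) : ℝ := 𝔼 j, 𝔼 k, (𝔼 i, d i j * d i k) ^ 2

theorem fourCycleDensity_nonneg (d : ι → κ → ℝ) : 0 ≤ fourCycleDensity d :=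
  Finset.expect_nonneg fun _ _ => Finset.expect_nonneg fun _ _ => sq_nonneg _

theorem fourCycleDensity_eq_expect (d : ι → κ → ℝ) : fourCycleDensity d =
    𝔼 j, 𝔼 k, 𝔼 i, 𝔼 i', d i j * d i k * (d i' j * d i' k) := by
  simp only [fourCycleDensity, sq, Finset.expect_mul_expect]

theorem expect_expect_mul_sq_le (f g : ι → κ → ℝ) :
    (𝔼 i, 𝔼 j, f i j * g i j) ^ 2 ≤ (𝔼 i, 𝔼 j, f i j ^ 2) * 𝔼 i, 𝔼 j, g i j ^ 2 := by
  simp only [← Finset.expect_product', Finset.univ_product_univ]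
  exact Finset.expect_mul_sq_le_sq_mul_sq _ _ _

theorem expect_bilinear_pow_four_le (d : ι → κ → ℝ) (f : ι → ℝ) (g : κ → ℝ) :
    (𝔼 i, 𝔼 j, f i * g j * d i j) ^ 4 ≤
      (𝔼 i, f i ^ 2) ^ 2 * (𝔼 j, g j ^ 2) ^ 2 * fourCycleDensity d := by
  have sum_over_j : (𝔼 i, 𝔼 j, f i * g j * d i j) ^ 2 ≤
      (𝔼 i, f i ^ 2) * 𝔼 i, (𝔼 j, g j * d i j) ^ 2 := by
    simpa only [Finset.mul_expect, mul_assoc] using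
      Finset.expect_mul_sq_le_sq_mul_sq Finset.univ f fun i => 𝔼 j, g j * d i j
  have open_square : 𝔼 i, (𝔼 j, g j * d i j) ^ 2 =
      𝔼 j, 𝔼 k, g j * g k * 𝔼 i, d i j * d i k := by
    simp only [sq, Finset.expect_mul_expect]
    simp only [Finset.mul_expect]
    rw [Finset.expect_comm]
    refine Finset.expect_congr rfl fun j _ => ?_
    rw [Finset.expect_comm]
    exact Finset.expect_congr rfl fun k _ => Finset.expect_congr rfl fun i _ => by ring
  have sum_over_i : (𝔼 i, (𝔼 j, g j * d i j) ^ 2) ^ 2 ≤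
      (𝔼 j, g j ^ 2) ^ 2 * fourCycleDensity d := by
    have h := expect_expect_mul_sq_le (fun j k => g j * g k) fun j k => 𝔼 i, d i j * d i k
    simp only [mul_pow, ← Finset.mul_expect, ← Finset.expect_mul] at h
    rwa [open_square, sq (𝔼 j, g j ^ 2)]
  calc (𝔼 i, 𝔼 j, f i * g j * d i j) ^ 4
      = ((𝔼 i, 𝔼 j, f i * g j * d i j) ^ 2) ^ 2 := by ring
    _ ≤ ((𝔼 i, f i ^ 2) * 𝔼 i, (𝔼 j, g j * d i j) ^ 2) ^ 2 := by gcongr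
    _ = (𝔼 i, f i ^ 2) ^ 2 * (𝔼 i, (𝔼 j, g j * d i j) ^ 2) ^ 2 := mul_pow _ _ _
    _ ≤ (𝔼 i, f i ^ 2) ^ 2 * ((𝔼 j, g j ^ 2) ^ 2 * fourCycleDensity d) := by gcongr
    _ = _ := (mul_assoc _ _ _).symm

end FourCycle

section RandomFourCycle

variable {V : Type*} [Fintype V] [DecidableEq V] {v : Sym2 V → ℝ}

theorem sum_signWeight_mul_fourCycle_eq_zero (v : Sym2 V → ℝ) {i i' j k : V} (hi : i ≠ i')
    (hj : j ≠ k) :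
    ∑ ε, signWeight v ε * ((ε s(i, j) - v s(i, j)) * (ε s(i, k) - v s(i, k)) *
      ((ε s(i', j) - v s(i', j)) * (ε s(i', k) - v s(i', k)))) = 0 := by
  -- The four edges are distinct, except that `ij` and `i'k` coincide when `i = k` and `i' = j`.
  by_cases coincide : i = k ∧ i' = j
  · obtain ⟨rfl, rfl⟩ := coincide
    rw [← sum_signWeight_mul_eq_zero v s(i, i) fun ε => (ε s(i, i') - v s(i, i')) *
      ((ε s(i', i') - v s(i', i')) * (ε s(i', i) - v s(i', i)))]
    · exact Finset.sum_congr rfl fun ε _ => by ring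
    · intro ε s
      rw [Function.update_of_ne, Function.update_of_ne, Function.update_of_ne] <;> grind
  · rw [← sum_signWeight_mul_eq_zero v s(i, j) fun ε => (ε s(i, k) - v s(i, k)) *
      ((ε s(i', j) - v s(i', j)) * (ε s(i', k) - v s(i', k)))]
    · exact Finset.sum_congr rfl fun ε _ => by ring
    · intro ε s
      rw [Function.update_of_ne, Function.update_of_ne, Function.update_of_ne] <;> grind

theorem sum_signWeight_mul_fourCycle_le (hv : ∀ e, |v e| ≤ 1) (i i' j k : V) :
    ∑ ε, signWeight v ε * ((ε s(i, j) - v s(i, j)) * (ε s(i, k) - v s(i, k)) *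
      ((ε s(i', j) - v s(i', j)) * (ε s(i', k) - v s(i', k)))) ≤
      (if i = i' then 16 else 0) + if j = k then 16 else 0 := by
  have abs_sub_le (ε : Sym2 V → ℤˣ) (e : Sym2 V) : |(ε e : ℝ) - v e| ≤ 2 := by
    have h := abs_le.1 (hv e)
    rcases Int.units_eq_one_or (ε e) with hε | hε <;> norm_num [hε, abs_le] <;>
      constructor <;> linarith
  have le_sixteen : ∑ ε, signWeight v ε * ((ε s(i, j) - v s(i, j)) * (ε s(i, k) - v s(i, k)) *
      ((ε s(i', j) - v s(i', j)) * (ε s(i', k) - v s(i', k)))) ≤ 16 := by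
    rw [← one_mul (16 : ℝ), ← sum_signWeight v, Finset.sum_mul]
    refine Finset.sum_le_sum fun ε _ => mul_le_mul_of_nonneg_left ?_ (signWeight_nonneg hv ε)
    refine (le_abs_self _).trans ?_
    simp only [abs_mul]
    calc _ ≤ (2 * 2 * (2 * 2) : ℝ) := by gcongr <;> exact abs_sub_le _ _
      _ = 16 := by norm_num
  rcases eq_or_ne i i' with hi | hi
  · rw [if_pos hi]
    exact le_sixteen.trans (le_add_of_nonneg_right (by split_ifs <;> norm_num))
  rcases eq_or_ne j k with hj | hj
  · rw [if_pos hj]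
    exact le_sixteen.trans (le_add_of_nonneg_left (by split_ifs <;> norm_num))
  · rw [sum_signWeight_mul_fourCycle_eq_zero v hi hj, if_neg hi, if_neg hj, add_zero]

theorem sum_signWeight_mul_fourCycleDensity_le [Nonempty V] (hv : ∀ e, |v e| ≤ 1) :
    ∑ ε, signWeight v ε * fourCycleDensity (fun i j => (ε s(i, j) : ℝ) - v s(i, j)) ≤
      32 / Fintype.card V := by
  simp only [fourCycleDensity_eq_expect, Finset.mul_expect, ← Finset.expect_sum_comm]
  calc _ ≤ 𝔼 j : V, 𝔼 k : V, 𝔼 i : V, 𝔼 i' : V,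
        (((if i = i' then 16 else 0) + if j = k then 16 else 0) : ℝ) :=
        Finset.expect_le_expect fun j _ => Finset.expect_le_expect fun k _ =>
          Finset.expect_le_expect fun i _ => Finset.expect_le_expect fun i' _ =>
            sum_signWeight_mul_fourCycle_le hv i i' j k
    _ = 32 / Fintype.card V := by
        simp [Finset.expect_add_distrib, NNRat.smul_def]
        ring

end RandomFourCycle

section Sample

variable {V : Type} [DecidableEq V]

/-- The weights `W (x i) (x j)` of the random graph sampled from `W` at the points `x`. Loops get
weight `0`, so that a product over a set of pairs that contains a loop vanishes. -/
noncomputable def SymmKernel.sample (W : SymmKernel) (x : V → I) (e : Sym2 V) : ℝ :=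
  if e.IsDiag then 0 else W.onEdge x e

theorem SymmKernel.sample_mk_of_ne (W : SymmKernel) (x : V → I) {i j : V} (hij : i ≠ j) :
    W.sample x s(i, j) = W (x i) (x j) :=
  if_neg hij

theorem SymmKernel.abs_sample_le {W : SymmKernel} (hb : ∀ x y, |W x y| ≤ 1) (x : V → I)
    (e : Sym2 V) : |W.sample x e| ≤ 1 := by
  induction e with
  | h i j =>
    rw [SymmKernel.sample]
    split_ifs
    · simp
    · exact hb _ _

theorem SymmKernel.measurable_sample {W : SymmKernel} (hm : Measurable fun p : I × I => W p.1 p.2)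
    (e : Sym2 V) : Measurable fun x : V → I => W.sample x e := by
  induction e with
  | h i j =>
    unfold SymmKernel.sample
    split_ifs
    · exact measurable_const
    · exact hm.comp (f := fun x : V → I => (x i, x j)) (by fun_prop)

variable [Fintype V]

theorem simpleDensity_fromEdgeSet (W : SymmKernel) {t : Finset (Sym2 V)}
    (ht : ∀ e ∈ t, ¬ e.IsDiag) :
    simpleDensity (SimpleGraph.fromEdgeSet (t : Set (Sym2 V))) W =
      ∫ x : V → I, ∏ e ∈ t, W.sample x e := by
  refine integral_congr_ae (ae_of_all _ fun x => Finset.prod_congr ?_ fun e he => ?_)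
  · ext e
    simpa using ht e
  · exact (if_neg (ht e (by simpa using he))).symm

theorem integral_prod_sample_eq {W W' : SymmKernel}
    (h : ∀ F : SimpleGraph V, simpleDensity F W' = simpleDensity F W) (t : Finset (Sym2 V)) :
    ∫ x : V → I, ∏ e ∈ t, W.sample x e = ∫ x : V → I, ∏ e ∈ t, W'.sample x e := by
  by_cases ht : ∀ e ∈ t, ¬ e.IsDiag
  · rw [← simpleDensity_fromEdgeSet W ht, ← simpleDensity_fromEdgeSet W' ht, h]
  · push Not at ht
    obtain ⟨e, het, he⟩ := ht
    have prod_eq_zero (U : SymmKernel) (x : V → I) : ∏ e ∈ t, U.sample x e = 0 :=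
      Finset.prod_eq_zero het (if_pos he)
    simp only [prod_eq_zero]

theorem signWeight_eq_sum {E : Type*} [Fintype E] (v : E → ℝ) (ε : E → ℤˣ) :
    signWeight v ε =
      (∑ t : Finset E, (∏ e ∈ t, (ε e : ℝ)) * ∏ e ∈ t, v e) / 2 ^ Fintype.card E := by
  classical
  simp only [signWeight, Finset.prod_div_distrib, Finset.prod_one_add, Finset.powerset_univ,
    Finset.prod_mul_distrib, Finset.prod_const, Finset.card_univ]

variable {W W' : SymmKernel}

theorem measurable_signWeight_sample (hm : Measurable fun p : I × I => W p.1 p.2)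
    (ε : Sym2 V → ℤˣ) : Measurable fun x : V → I => signWeight (W.sample x) ε :=
  Finset.measurable_prod _ fun e _ =>
    ((W.measurable_sample hm e).const_mul _).const_add _ |>.div_const _

theorem integrable_prod_sample (hm : Measurable fun p : I × I => W p.1 p.2)
    (hb : ∀ x y, |W x y| ≤ 1) (t : Finset (Sym2 V)) :
    Integrable fun x : V → I => ∏ e ∈ t, W.sample x e := by
  refine Integrable.of_bound (C := 1) (Finset.measurable_prod _ fun e _ =>
    W.measurable_sample hm e).aestronglyMeasurable (ae_of_all _ fun x => ?_)
  rw [Real.norm_eq_abs, Finset.abs_prod]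
  exact Finset.prod_le_one (fun _ _ => abs_nonneg _) fun e _ => W.abs_sample_le hb x e

theorem integrable_signWeight_sample (hm : Measurable fun p : I × I => W p.1 p.2)
    (hb : ∀ x y, |W x y| ≤ 1) (ε : Sym2 V → ℤˣ) :
    Integrable fun x : V → I => signWeight (W.sample x) ε := by
  simp only [signWeight_eq_sum]
  exact (integrable_finsetSum _ fun t _ => (integrable_prod_sample hm hb t).const_mul _).div_const _

theorem integral_signWeight_sample (hm : Measurable fun p : I × I => W p.1 p.2)
    (hb : ∀ x y, |W x y| ≤ 1) (ε : Sym2 V → ℤˣ) :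
    ∫ x : V → I, signWeight (W.sample x) ε =
      (∑ t : Finset (Sym2 V), (∏ e ∈ t, (ε e : ℝ)) * ∫ x : V → I, ∏ e ∈ t, W.sample x e) /
        2 ^ Fintype.card (Sym2 V) := by
  simp only [signWeight_eq_sum]
  rw [integral_div, integral_finsetSum _ fun t _ => (integrable_prod_sample hm hb t).const_mul _]
  simp only [integral_const_mul]

/-- The law of the sample points when independent signs with means `W.sample x` are drawn as well,
restricted to the event that the signs come out as `ε`. -/
noncomputable def signedSampleLaw (W : SymmKernel) (ε : Sym2 V → ℤˣ) : Measure (V → I) :=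
  volume.withDensity fun x => ENNReal.ofReal (signWeight (W.sample x) ε)

theorem signedSampleLaw_univ (hm : Measurable fun p : I × I => W p.1 p.2)
    (hb : ∀ x y, |W x y| ≤ 1) (ε : Sym2 V → ℤˣ) :
    signedSampleLaw W ε Set.univ = ENNReal.ofReal (∫ x : V → I, signWeight (W.sample x) ε) := by
  rw [signedSampleLaw, withDensity_apply _ .univ, Measure.restrict_univ,
    ofReal_integral_eq_lintegral_ofReal (integrable_signWeight_sample hm hb ε)
      (ae_of_all _ fun x => signWeight_nonneg (W.abs_sample_le hb x) ε)]

theorem sum_signedSampleLaw (hm : Measurable fun p : I × I => W p.1 p.2)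
    (hb : ∀ x y, |W x y| ≤ 1) :
    ∑ ε : Sym2 V → ℤˣ, signedSampleLaw W ε = (volume : Measure (V → I)) := by
  ext s hs
  simp only [signedSampleLaw, Measure.coe_finsetSum, Finset.sum_apply, withDensity_apply _ hs]
  rw [← lintegral_finsetSum _ fun ε _ => (measurable_signWeight_sample hm ε).ennreal_ofReal,
    ← setLIntegral_one]
  congr with x
  rw [← ENNReal.ofReal_sum_of_nonneg fun ε _ => signWeight_nonneg (W.abs_sample_le hb x) ε,
    sum_signWeight, ENNReal.ofReal_one]

theorem signedSampleLaw_univ_congr (hm : Measurable fun p : I × I => W p.1 p.2)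
    (hm' : Measurable fun p : I × I => W' p.1 p.2) (hb : ∀ x y, |W x y| ≤ 1)
    (hb' : ∀ x y, |W' x y| ≤ 1) (h : ∀ F : SimpleGraph V, simpleDensity F W' = simpleDensity F W)
    (ε : Sym2 V → ℤˣ) : signedSampleLaw W ε Set.univ = signedSampleLaw W' ε Set.univ := by
  rw [signedSampleLaw_univ hm hb, signedSampleLaw_univ hm' hb', integral_signWeight_sample hm hb,
    integral_signWeight_sample hm' hb']
  simp only [integral_prod_sample_eq h]

end Sample

theorem exists_common_index_of_sum_measure_lt {E α β : Type*} [Fintype E] [MeasurableSpace α]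
    [MeasurableSpace β] {μ : E → Measure α} {μ' : E → Measure β}
    (h : ∀ ε, μ ε Set.univ = μ' ε Set.univ) {A : E → Set α} {B : E → Set β}
    (hlt : ∑ ε, μ ε (A ε) + ∑ ε, μ' ε (B ε) < ∑ ε, μ ε Set.univ) :
    ∃ ε, (∃ x, x ∉ A ε) ∧ ∃ y, y ∉ B ε := by
  simp only [← Set.ne_univ_iff_exists_notMem]
  by_contra! covered
  refine hlt.not_ge ?_
  rw [← Finset.sum_add_distrib]
  refine Finset.sum_le_sum fun ε _ => ?_
  by_cases hA : A ε = Set.univ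
  · exact hA ▸ le_self_add
  · exact (h ε).trans_le (covered ε hA ▸ le_add_self)

section LawOfLargeNumbers

variable {ι Ω : Type*} [Fintype ι] [MeasurableSpace Ω] {μ : Measure Ω}

theorem integrable_expect {f : ι → Ω → ℝ} (hf : ∀ i, Integrable (f i) μ) :
    Integrable (fun x => 𝔼 i, f i x) μ := by
  simp only [Fintype.expect_eq_sum_div_card]
  exact (integrable_finsetSum _ fun i _ => hf i).div_const _

theorem integral_expect {f : ι → Ω → ℝ} (hf : ∀ i, Integrable (f i) μ) :
    ∫ x, 𝔼 i, f i x ∂μ = 𝔼 i, ∫ x, f i x ∂μ := by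
  simp only [Fintype.expect_eq_sum_div_card]
  rw [integral_div, integral_finsetSum _ fun i _ => hf i]

variable [Nonempty ι] [IsProbabilityMeasure μ]

theorem measure_pi_le_abs_expect_sub_integral {f : Ω → ℝ} (hf : MemLp f 2 μ) {δ : ℝ} (hδ : 0 < δ) :
    Measure.pi (fun _ : ι => μ) {x | δ ≤ |𝔼 i, f (x i) - ∫ t, f t ∂μ|} ≤
      ENNReal.ofReal (ProbabilityTheory.variance f μ / (Fintype.card ι * δ ^ 2)) := by
  have eval (i : ι) : MeasurePreserving (fun x : ι → Ω => x i) (Measure.pi fun _ => μ) μ :=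
    measurePreserving_eval (fun _ => μ) i
  have memLp_eval (i : ι) : MemLp (fun x : ι → Ω => f (x i)) 2 (Measure.pi fun _ => μ) :=
    hf.comp_measurePreserving (eval i)
  have hsum : (fun x : ι → Ω => 𝔼 i, f (x i)) =
      (Fintype.card ι : ℝ)⁻¹ • ∑ i, fun x : ι → Ω => f (x i) := by
    ext x
    simp [Fintype.expect_eq_sum_div_card, div_eq_inv_mul]
  have memLp_expect : MemLp (fun x : ι → Ω => 𝔼 i, f (x i)) 2 (Measure.pi fun _ => μ) :=
    hsum ▸ (memLp_finsetSum' _ fun i _ => memLp_eval i).const_smul _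
  have mean : ∫ x, 𝔼 i, f (x i) ∂Measure.pi (fun _ : ι => μ) = ∫ t, f t ∂μ := by
    have h (i : ι) : ∫ x, f (x i) ∂Measure.pi (fun _ : ι => μ) = ∫ t, f t ∂μ := by
      rw [← integral_map (φ := fun x : ι → Ω => x i) (eval i).aemeasurable
        ((eval i).map_eq.symm ▸ hf.1), (eval i).map_eq]
    rw [integral_expect fun i => (memLp_eval i).integrable one_le_two]
    simp only [h, Fintype.expect_const]
  have variance : ProbabilityTheory.variance (fun x : ι → Ω => 𝔼 i, f (x i))
      (Measure.pi fun _ => μ) = ProbabilityTheory.variance f μ / Fintype.card ι := by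
    rw [hsum, ProbabilityTheory.variance_smul, ProbabilityTheory.variance_sum_pi fun _ => hf]
    simp only [Finset.sum_const, Finset.card_univ, nsmul_eq_mul]
    field_simp
  have chebyshev := ProbabilityTheory.meas_ge_le_variance_div_sq memLp_expect hδ
  rwa [mean, variance, div_div] at chebyshev

end LawOfLargeNumbers

section OffDiagMean

variable {ι Ω : Type*} [Fintype ι] [DecidableEq ι]

/-- The average of `h` over the pairs of sample points, where the pairs `(i, i)` count as `0`. -/
noncomputable def offDiagMean (h : Ω × Ω → ℝ) (x : ι → Ω) : ℝ :=
  𝔼 i, 𝔼 j, if i = j then 0 else h (x i, x j)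

theorem offDiagMean_nonneg {h : Ω × Ω → ℝ} (hh : 0 ≤ h) (x : ι → Ω) : 0 ≤ offDiagMean h x :=
  Finset.expect_nonneg fun i _ => Finset.expect_nonneg fun j _ => by
    split_ifs
    exacts [le_rfl, hh _]

theorem abs_expect_expect_sub_offDiagMean_le [Nonempty ι] {h : Ω × Ω → ℝ} {C : ℝ}
    (hC : ∀ p, |h p| ≤ C) (x : ι → Ω) :
    |𝔼 i, 𝔼 j, h (x i, x j) - offDiagMean h x| ≤ C / Fintype.card ι := by
  simp only [offDiagMean, ← Finset.expect_sub_distrib]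
  calc _ ≤ 𝔼 i : ι, 𝔼 j : ι, if i = j then C else 0 :=
        (Finset.abs_expect_le _ _).trans <| Finset.expect_le_expect fun i _ =>
          (Finset.abs_expect_le _ _).trans <| Finset.expect_le_expect fun j _ => by
            split_ifs
            exacts [by simpa using hC _, by simp]
    _ = C / Fintype.card ι := by simp [NNRat.smul_def, div_eq_inv_mul]

theorem abs_offDiagMean_sub_le (h h' : Ω × Ω → ℝ) (x : ι → Ω) :
    |offDiagMean h x - offDiagMean h' x| ≤ offDiagMean (fun p => |h p - h' p|) x := by
  simp only [offDiagMean, ← Finset.expect_sub_distrib]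
  refine (Finset.abs_expect_le _ _).trans <| Finset.expect_le_expect fun i _ =>
    (Finset.abs_expect_le _ _).trans <| Finset.expect_le_expect fun j _ => ?_
  split_ifs <;> simp

theorem measure_pi_le_offDiagMean [Nonempty ι] [MeasurableSpace Ω] {μ : Measure Ω}
    [IsProbabilityMeasure μ] {h : Ω × Ω → ℝ} (hint : Integrable h (μ.prod μ))
    (hnonneg : 0 ≤ h) {δ : ℝ} (hδ : 0 < δ) :
    Measure.pi (fun _ : ι => μ) {x | δ ≤ offDiagMean h x} ≤
      ENNReal.ofReal ((∫ p, h p ∂μ.prod μ) / δ) := by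
  have term (i j : ι) :
      Integrable (fun x : ι → Ω => if i = j then 0 else h (x i, x j)) (Measure.pi fun _ => μ) ∧
      ∫ x : ι → Ω, (if i = j then 0 else h (x i, x j)) ∂Measure.pi (fun _ => μ) ≤
        ∫ p, h p ∂μ.prod μ := by
    rcases eq_or_ne i j with hij | hij
    · simpa [hij] using integral_nonneg hnonneg
    · have pair := measurePreserving_eval_pair μ hij
      simp only [if_neg hij]
      refine ⟨pair.integrable_comp_of_integrable hint, le_of_eq ?_⟩
      rw [← pair.map_eq, integral_map pair.aemeasurable (pair.map_eq.symm ▸ hint.1)]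
  have row (i : ι) := integrable_expect fun j => (term i j).1
  have integral_le : ∫ x, offDiagMean h x ∂Measure.pi (fun _ : ι => μ) ≤ ∫ p, h p ∂μ.prod μ := by
    unfold offDiagMean
    rw [integral_expect row]
    refine Finset.expect_le Finset.univ_nonempty fun i _ => ?_
    rw [integral_expect fun j => (term i j).1]
    exact Finset.expect_le Finset.univ_nonempty fun j _ => (term i j).2
  have markov := mul_meas_ge_le_integral_of_nonneg (ae_of_all _ fun x : ι → Ω =>
    offDiagMean_nonneg hnonneg x) (integrable_expect row) δ
  rw [← ofReal_measureReal]
  exact ENNReal.ofReal_le_ofReal ((le_div_iff₀' hδ).2 (markov.trans integral_le))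

end OffDiagMean

/-- Sample points `x` with signs `ε` are typical for `W` if the averages of the test functions in
`S` are close to their integrals, the approximations `P k` of `W` stay good along the sample, and
`ε` is close to the sampled weights in cut norm. -/
structure IsTypicalSample (S : Finset (I →ᵇ ℝ)) (δ : ℝ) (P : ℕ → I × I →ᵇ ℝ) (W : SymmKernel)
    {V : Type} [Fintype V] [DecidableEq V] (ε : Sym2 V → ℤˣ) (x : V → I) : Prop where
  average : ∀ f ∈ S, |𝔼 i, f (x i) - ∫ t, f t| < δ
  approx : ∀ k, offDiagMean (fun p => |W p.1 p.2 - P k p|) x < (1 / 2) ^ k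
  fourCycle : fourCycleDensity (fun i j => (ε s(i, j) : ℝ) - W.sample x s(i, j)) < δ

section TypicalSample

variable {W W' : SymmKernel}

section

variable {V : Type} [Fintype V] [DecidableEq V] [Nonempty V]

theorem sum_signedSampleLaw_le_fourCycleDensity (hm : Measurable fun p : I × I => W p.1 p.2)
    (hb : ∀ x y, |W x y| ≤ 1) {δ : ℝ} (hδ : 0 < δ) :
    ∑ ε : Sym2 V → ℤˣ, signedSampleLaw W ε
        {x | δ ≤ fourCycleDensity fun i j => (ε s(i, j) : ℝ) - W.sample x s(i, j)} ≤
      ENNReal.ofReal (32 / Fintype.card V / δ) := by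
  let D (ε : Sym2 V → ℤˣ) (x : V → I) : ℝ :=
    fourCycleDensity fun i j => (ε s(i, j) : ℝ) - W.sample x s(i, j)
  have measurable_D (ε : Sym2 V → ℤˣ) : Measurable (D ε) := by
    have h (i j : V) : Measurable fun x : V → I => (ε s(i, j) : ℝ) - W.sample x s(i, j) :=
      (W.measurable_sample hm _).const_sub _
    simp only [D, fourCycleDensity, Fintype.expect_eq_sum_div_card]
    fun_prop
  have weighted (ε : Sym2 V → ℤˣ) : ENNReal.ofReal δ * signedSampleLaw W ε {x | δ ≤ D ε x} ≤
      ∫⁻ x : V → I, ENNReal.ofReal (signWeight (W.sample x) ε * D ε x) := by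
    have markov := mul_meas_ge_le_lintegral (μ := signedSampleLaw W ε)
      (measurable_D ε).ennreal_ofReal (ENNReal.ofReal δ)
    simp only [ENNReal.ofReal_le_ofReal_iff (fourCycleDensity_nonneg _), D] at markov
    refine markov.trans_eq ?_
    rw [signedSampleLaw, lintegral_withDensity_eq_lintegral_mul _
      (measurable_signWeight_sample hm ε).ennreal_ofReal (measurable_D ε).ennreal_ofReal]
    exact lintegral_congr fun x =>
      (ENNReal.ofReal_mul (signWeight_nonneg (W.abs_sample_le hb x) ε)).symm
  rw [ENNReal.ofReal_div_of_pos hδ, ENNReal.le_div_iff_mul_le (by simp [hδ]) (by simp), mul_comm,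
    Finset.mul_sum]
  calc _ ≤ ∑ ε : Sym2 V → ℤˣ, ∫⁻ x : V → I, ENNReal.ofReal (signWeight (W.sample x) ε * D ε x) :=
        Finset.sum_le_sum fun ε _ => weighted ε
    _ = ∫⁻ x : V → I, ENNReal.ofReal (∑ ε, signWeight (W.sample x) ε * D ε x) := by
        have measurable_term (ε : Sym2 V → ℤˣ) :
            Measurable fun x => ENNReal.ofReal (signWeight (W.sample x) ε * D ε x) :=
          ((measurable_signWeight_sample hm ε).mul (measurable_D ε)).ennreal_ofReal
        rw [← lintegral_finsetSum _ fun ε _ => measurable_term ε]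
        exact lintegral_congr fun x => (ENNReal.ofReal_sum_of_nonneg fun ε _ => mul_nonneg
          (signWeight_nonneg (W.abs_sample_le hb x) ε) (fourCycleDensity_nonneg _)).symm
    _ ≤ ∫⁻ _ : V → I, ENNReal.ofReal (32 / Fintype.card V) :=
        lintegral_mono fun x => ENNReal.ofReal_le_ofReal
          (sum_signWeight_mul_fourCycleDensity_le (W.abs_sample_le hb x))
    _ = ENNReal.ofReal (32 / Fintype.card V) := by simp

theorem volume_exists_le_offDiagMean_le {P : ℕ → I × I →ᵇ ℝ}
    (hm : Measurable fun p : I × I => W p.1 p.2) (hb : ∀ x y, |W x y| ≤ 1)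
    (hP : ∀ k, ∫ p : I × I, |W p.1 p.2 - P k p| ≤ (1 / 4) ^ k / 16) :
    volume {x : V → I | ∃ k, (1 / 2) ^ k ≤ offDiagMean (fun p => |W p.1 p.2 - P k p|) x} ≤
      ENNReal.ofReal (1 / 8) := by
  have integrable_W : Integrable fun p : I × I => W p.1 p.2 :=
    Integrable.of_bound hm.aestronglyMeasurable 1 (ae_of_all _ fun p => hb p.1 p.2)
  have each (k : ℕ) :
      volume {x : V → I | (1 / 2) ^ k ≤ offDiagMean (fun p => |W p.1 p.2 - P k p|) x} ≤
        ENNReal.ofReal ((1 / 16) * (1 / 2) ^ k) := by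
    refine (measure_pi_le_offDiagMean (integrable_W.sub ((P k).integrable _)).abs
      (fun p => abs_nonneg _) (by positivity)).trans (ENNReal.ofReal_le_ofReal ?_)
    rw [div_le_iff₀ (by positivity), mul_assoc, ← mul_pow]
    exact (hP k).trans_eq (by norm_num [div_eq_inv_mul])
  rw [Set.ofPred_exists]
  refine (measure_iUnion_le _).trans ((ENNReal.tsum_le_tsum each).trans_eq ?_)
  rw [← ENNReal.ofReal_tsum_of_nonneg (fun k => by positivity)
    (summable_geometric_two.mul_left _), tsum_mul_left, tsum_geometric_two]
  norm_num

theorem sum_signedSampleLaw_not_isTypicalSample_le {S : Finset (I →ᵇ ℝ)} {δ : ℝ} (hδ : 0 < δ)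
    {P : ℕ → I × I →ᵇ ℝ} (hm : Measurable fun p : I × I => W p.1 p.2) (hb : ∀ x y, |W x y| ≤ 1)
    (hP : ∀ k, ∫ p : I × I, |W p.1 p.2 - P k p| ≤ (1 / 4) ^ k / 16) :
    ∑ ε : Sym2 V → ℤˣ, signedSampleLaw W ε {x | ¬ IsTypicalSample S δ P W ε x} ≤
      ∑ f ∈ S, ENNReal.ofReal
          (ProbabilityTheory.variance (fun t => f t) volume / (Fintype.card V * δ ^ 2)) +
        ENNReal.ofReal (1 / 8) + ENNReal.ofReal (32 / Fintype.card V / δ) := by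
  let A : Set (V → I) := ⋃ f ∈ S, {x | δ ≤ |𝔼 i, f (x i) - ∫ t, f t|}
  let B : Set (V → I) := {x | ∃ k, (1 / 2) ^ k ≤ offDiagMean (fun p => |W p.1 p.2 - P k p|) x}
  let D (ε : Sym2 V → ℤˣ) : Set (V → I) :=
    {x | δ ≤ fourCycleDensity fun i j => (ε s(i, j) : ℝ) - W.sample x s(i, j)}
  have cover (ε : Sym2 V → ℤˣ) : {x | ¬ IsTypicalSample S δ P W ε x} ⊆ A ∪ B ∪ D ε := by
    intro x hx
    contrapose! hx
    simp only [A, B, D, Set.mem_union, Set.mem_iUnion, Set.mem_ofPred_eq, not_or, not_exists,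
      not_le] at hx
    exact not_not.2 ⟨hx.1.1, hx.1.2, hx.2⟩
  have volume_A : volume A ≤ ∑ f ∈ S, ENNReal.ofReal
      (ProbabilityTheory.variance (fun t => f t) volume / (Fintype.card V * δ ^ 2)) :=
    (measure_biUnion_finset_le _ _).trans <| Finset.sum_le_sum fun f _ =>
      measure_pi_le_abs_expect_sub_integral (f.memLp_top.mono_exponent le_top) hδ
  calc _ ≤ ∑ ε : Sym2 V → ℤˣ, (signedSampleLaw W ε (A ∪ B) + signedSampleLaw W ε (D ε)) :=
        Finset.sum_le_sum fun ε _ => (measure_mono (cover ε)).trans (measure_union_le _ _)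
    _ = volume (A ∪ B) + ∑ ε : Sym2 V → ℤˣ, signedSampleLaw W ε (D ε) := by
        rw [Finset.sum_add_distrib, ← sum_signedSampleLaw hm hb, Measure.coe_finsetSum,
          Finset.sum_apply]
    _ ≤ _ := add_le_add ((measure_union_le _ _).trans (add_le_add volume_A
        (volume_exists_le_offDiagMean_le hm hb hP)))
        (sum_signedSampleLaw_le_fourCycleDensity hm hb hδ)

end

theorem eventually_sum_signedSampleLaw_not_isTypicalSample_lt {S : Finset (I →ᵇ ℝ)} {δ : ℝ}
    (hδ : 0 < δ) {P : ℕ → I × I →ᵇ ℝ} (hm : Measurable fun p : I × I => W p.1 p.2)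
    (hb : ∀ x y, |W x y| ≤ 1)
    (hP : ∀ k, ∫ p : I × I, |W p.1 p.2 - P k p| ≤ (1 / 4) ^ k / 16) :
    ∀ᶠ n : ℕ in atTop, ∑ ε : Sym2 (Fin (n + 1)) → ℤˣ,
      signedSampleLaw W ε {x | ¬ IsTypicalSample S δ P W ε x} < 2⁻¹ := by
  have card_atTop : Tendsto (fun n : ℕ => (Fintype.card (Fin (n + 1)) : ℝ)) atTop atTop := by
    simp only [Fintype.card_fin]
    exact tendsto_natCast_atTop_atTop.comp (tendsto_add_atTop_nat 1)
  have lim_average (f : I →ᵇ ℝ) : Tendsto (fun n : ℕ => ENNReal.ofReal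
      (ProbabilityTheory.variance (fun t => f t) volume /
        (Fintype.card (Fin (n + 1)) * δ ^ 2))) atTop (𝓝 (ENNReal.ofReal 0)) :=
    ENNReal.tendsto_ofReal ((card_atTop.atTop_mul_const (by positivity)).const_div_atTop _)
  have lim_fourCycle : Tendsto (fun n : ℕ =>
      ENNReal.ofReal (32 / Fintype.card (Fin (n + 1)) / δ)) atTop (𝓝 (ENNReal.ofReal (0 / δ))) :=
    ENNReal.tendsto_ofReal ((card_atTop.const_div_atTop _).div_const _)
  have lim := ((tendsto_finsetSum S fun f _ => lim_average f).add_const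
    (ENNReal.ofReal (1 / 8))).add lim_fourCycle
  refine (lim.eventually_lt_const ?_).mono fun n hn =>
    (sum_signedSampleLaw_not_isTypicalSample_le hδ hm hb hP).trans_lt hn
  rw [Finset.sum_eq_zero fun _ _ => ENNReal.ofReal_zero, zero_div, ENNReal.ofReal_zero, zero_add,
    add_zero, ← ENNReal.ofReal_ofNat 2, ← ENNReal.ofReal_inv_of_pos two_pos,
    ENNReal.ofReal_lt_ofReal_iff (by positivity)]
  norm_num

theorem exists_common_isTypicalSample {P P' : ℕ → I × I →ᵇ ℝ}
    (hm : Measurable fun p : I × I => W p.1 p.2) (hm' : Measurable fun p : I × I => W' p.1 p.2)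
    (hb : ∀ x y, |W x y| ≤ 1) (hb' : ∀ x y, |W' x y| ≤ 1)
    (hP : ∀ k, ∫ p : I × I, |W p.1 p.2 - P k p| ≤ (1 / 4) ^ k / 16)
    (hP' : ∀ k, ∫ p : I × I, |W' p.1 p.2 - P' k p| ≤ (1 / 4) ^ k / 16)
    (h : ∀ (n : ℕ) (F : SimpleGraph (Fin n)), simpleDensity F W' = simpleDensity F W)
    (S : Finset (I →ᵇ ℝ)) {δ : ℝ} (hδ : 0 < δ) (N : ℕ) :
    ∃ n ≥ N, ∃ (ε : Sym2 (Fin (n + 1)) → ℤˣ) (x y : Fin (n + 1) → I),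
      IsTypicalSample S δ P W ε x ∧ IsTypicalSample S δ P' W' ε y := by
  obtain ⟨n, hNn, hn, hn'⟩ := ((eventually_ge_atTop N).and
    ((eventually_sum_signedSampleLaw_not_isTypicalSample_lt (S := S) hδ hm hb hP).and
      (eventually_sum_signedSampleLaw_not_isTypicalSample_lt (S := S) hδ hm' hb' hP'))).exists
  have total : ∑ ε : Sym2 (Fin (n + 1)) → ℤˣ, signedSampleLaw W ε Set.univ = 2⁻¹ + 2⁻¹ := by
    rw [ENNReal.inv_two_add_inv_two, ← measure_univ (μ := (volume : Measure (Fin (n + 1) → I))),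
      ← sum_signedSampleLaw hm hb, Measure.coe_finsetSum, Finset.sum_apply]
  obtain ⟨ε, ⟨x, hx⟩, y, hy⟩ := exists_common_index_of_sum_measure_lt
    (signedSampleLaw_univ_congr hm hm' hb hb' (h (n + 1))) (total ▸ ENNReal.add_lt_add hn hn')
  exact ⟨n, hNn, ε, x, y, not_not.1 hx, not_not.1 hy⟩

end TypicalSample

section Empirical

variable {ι Z : Type*} [Fintype ι] [Nonempty ι] [MeasurableSpace Z]

/-- The empirical distribution of the sample points `z`, each of mass `1 / card ι`. -/
noncomputable def empirical (z : ι → Z) : ProbabilityMeasure Z :=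
  ⟨(Fintype.card ι : ℝ≥0∞)⁻¹ • ∑ i, Measure.dirac (z i), ⟨by simp [ENNReal.inv_mul_cancel]⟩⟩

theorem integral_empirical (z : ι → Z) {f : Z → ℝ} (hf : StronglyMeasurable f) :
    ∫ t, f t ∂(empirical z : Measure Z) = 𝔼 i, f (z i) := by
  rw [empirical, ProbabilityMeasure.coe_mk, integral_smul_measure,
    integral_finsetSum_measure fun i _ => integrable_dirac' hf (by simp)]
  simp [integral_dirac' _ _ hf, Fintype.expect_eq_sum_div_card, div_eq_inv_mul]

theorem integral_empirical_prod (z : ι → Z) {f : Z × Z → ℝ} (hf : StronglyMeasurable f)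
    (hint : Integrable f ((empirical z : Measure Z).prod (empirical z))) :
    ∫ p, f p ∂(empirical z : Measure Z).prod (empirical z) = 𝔼 i, 𝔼 j, f (z i, z j) := by
  rw [integral_prod _ hint, integral_empirical z hf.integral_prod_right']
  exact Finset.expect_congr rfl fun i _ =>
    integral_empirical z (hf.comp_measurable measurable_prodMk_left)

end Empirical

section EmpiricalLimit

variable {α Z : Type*} {l : Filter α} {V : α → Type} [∀ a, Fintype (V a)] [∀ a, Nonempty (V a)]
  [TopologicalSpace Z] [MeasurableSpace Z] [BorelSpace Z] {z : ∀ a, V a → Z}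
  {γ : ProbabilityMeasure Z}

theorem tendsto_expect_of_tendsto_empirical (hγ : Tendsto (fun a => empirical (z a)) l (𝓝 γ))
    (f : Z →ᵇ ℝ) : Tendsto (fun a => 𝔼 i, f (z a i)) l (𝓝 (∫ t, f t ∂(γ : Measure Z))) := by
  refine (ProbabilityMeasure.tendsto_iff_forall_integral_tendsto.1 hγ f).congr fun a => ?_
  exact integral_empirical _ f.continuous.measurable.stronglyMeasurable

theorem measurePreserving_of_tendsto_empirical {X : Type*} [TopologicalSpace X]
    [MeasurableSpace X] [BorelSpace X] [HasOuterApproxClosed X] {ν : Measure X}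
    [IsFiniteMeasure ν] {π : Z → X} [l.NeBot]
    (hγ : Tendsto (fun a => empirical (z a)) l (𝓝 γ)) (hπ : Continuous π)
    (hν : ∀ f : X →ᵇ ℝ, Tendsto (fun a => 𝔼 i, f (π (z a i))) l (𝓝 (∫ t, f t ∂ν))) :
    MeasurePreserving π (γ : Measure Z) ν := by
  refine ⟨hπ.measurable, ext_of_forall_integral_eq_of_IsFiniteMeasure fun f => ?_⟩
  rw [integral_map hπ.aemeasurable f.continuous.aestronglyMeasurable]
  exact tendsto_nhds_unique
    (tendsto_expect_of_tendsto_empirical hγ (f.compContinuous ⟨π, hπ⟩)) (hν f)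

variable [SecondCountableTopology Z]

theorem tendsto_expect_expect_of_tendsto_empirical [TopologicalSpace.PseudoMetrizableSpace Z]
    (hγ : Tendsto (fun a => empirical (z a)) l (𝓝 γ)) (f : Z × Z →ᵇ ℝ) :
    Tendsto (fun a => 𝔼 i, 𝔼 j, f (z a i, z a j)) l
      (𝓝 (∫ p, f p ∂(γ : Measure Z).prod γ)) := by
  have prod_tendsto : Tendsto (fun a => (empirical (z a)).prod (empirical (z a))) l
      (𝓝 (γ.prod γ)) :=
    (ProbabilityMeasure.continuous_prod.tendsto (γ, γ)).comp (hγ.prodMk_nhds hγ)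
  refine (ProbabilityMeasure.tendsto_iff_forall_integral_tendsto.1 prod_tendsto f).congr
    fun a => ?_
  exact integral_empirical_prod _ f.continuous.measurable.stronglyMeasurable (f.integrable _)

variable [∀ a, DecidableEq (V a)]

theorem tendsto_offDiagMean_of_tendsto_empirical [TopologicalSpace.PseudoMetrizableSpace Z]
    (hγ : Tendsto (fun a => empirical (z a)) l (𝓝 γ))
    (hcard : Tendsto (fun a => Fintype.card (V a)) l atTop) (f : Z × Z →ᵇ ℝ) :
    Tendsto (fun a => offDiagMean f (z a)) l (𝓝 (∫ p, f p ∂(γ : Measure Z).prod γ)) := by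
  have diag : Tendsto (fun a => 𝔼 i, 𝔼 j, f (z a i, z a j) - offDiagMean f (z a)) l (𝓝 0) :=
    squeeze_zero_norm (fun a => abs_expect_expect_sub_offDiagMean_le f.norm_coe_le_norm (z a))
      ((tendsto_natCast_atTop_atTop.comp hcard).const_div_atTop ‖f‖)
  simpa using (tendsto_expect_expect_of_tendsto_empirical hγ f).sub diag

theorem tendsto_offDiagMean_of_approx [TopologicalSpace.PseudoMetrizableSpace Z]
    (hγ : Tendsto (fun a => empirical (z a)) l (𝓝 γ))
    (hcard : Tendsto (fun a => Fintype.card (V a)) l atTop) {h : Z × Z → ℝ}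
    (hint : Integrable h ((γ : Measure Z).prod γ)) {P : ℕ → Z × Z →ᵇ ℝ} {η : ℕ → ℝ}
    (hη : Tendsto η atTop (𝓝 0))
    (hsample : ∀ k a, offDiagMean (fun p => |h p - P k p|) (z a) ≤ η k)
    (hlimit : ∀ k, ∫ p, |h p - P k p| ∂(γ : Measure Z).prod γ ≤ η k) :
    Tendsto (fun a => offDiagMean h (z a)) l (𝓝 (∫ p, h p ∂(γ : Measure Z).prod γ)) := by
  refine TendstoUniformlyOnFilter.tendsto_of_eventually_tendsto (p := atTop)
    (F := fun k a => offDiagMean (P k) (z a))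
    (L := fun k => ∫ p, P k p ∂(γ : Measure Z).prod γ) ?_
    (Eventually.of_forall fun k => tendsto_offDiagMean_of_tendsto_empirical hγ hcard (P k)) ?_
  · rw [Metric.tendstoUniformlyOnFilter_iff]
    intro e he
    refine ((hη.eventually_lt_const he).prod_inl _).mono fun p hp => ?_
    rw [Real.dist_eq]
    exact ((abs_offDiagMean_sub_le _ _ _).trans (hsample p.1 p.2)).trans_lt hp
  · rw [tendsto_iff_norm_sub_tendsto_zero]
    refine squeeze_zero (fun _ => norm_nonneg _) (fun k => ?_) hη
    rw [norm_sub_rev, ← integral_sub hint ((P k).integrable _)]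
    exact (norm_integral_le_integral_norm _).trans (hlimit k)

end EmpiricalLimit

theorem ae_eq_zero_of_integral_mul_mul_eq_zero {Z T : Type*} [TopologicalSpace Z]
    [MeasurableSpace Z] [BorelSpace Z] [HasOuterApproxClosed Z] [TopologicalSpace T]
    [MeasurableSpace T] [BorelSpace T] [HasOuterApproxClosed T] {μ : Measure (Z × T)}
    [IsFiniteMeasure μ] {K : Z × T → ℝ} (hK : Integrable K μ)
    (h : ∀ (f : Z →ᵇ ℝ) (g : T →ᵇ ℝ), ∫ p, f p.1 * g p.2 * K p ∂μ = 0) : K =ᵐ[μ] 0 := by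
  have := isFiniteMeasure_withDensity_ofReal hK.2
  have := isFiniteMeasure_withDensity_ofReal hK.neg.2
  have integral_withDensity {J : Z × T → ℝ} (hJ : Integrable J μ) (F : Z × T → ℝ) :
      ∫ p, F p ∂μ.withDensity (fun p => ENNReal.ofReal (J p)) = ∫ p, F p * max (J p) 0 ∂μ := by
    rw [integral_withDensity_eq_integral_toReal_smul₀ hJ.1.aemeasurable.ennreal_ofReal
      (ae_of_all _ fun _ => ENNReal.ofReal_lt_top)]
    simp only [ENNReal.toReal_ofReal', smul_eq_mul, mul_comm]
  have densities_eq : μ.withDensity (fun p => ENNReal.ofReal (K p)) =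
      μ.withDensity fun p => ENNReal.ofReal ((-K) p) := by
    refine Measure.ext_of_integral_mul_boundedContinuousFunction fun f g => ?_
    have measurable_fg : Measurable fun p : Z × T => f p.1 * g p.2 :=
      (f.continuous.measurable.comp measurable_fst).mul
        (g.continuous.measurable.comp measurable_snd)
    have integrable_mul {J : Z × T → ℝ} (hJ : Integrable J μ) :
        Integrable (fun p => f p.1 * g p.2 * max (J p) 0) μ :=
      hJ.pos_part.bdd_mul (c := ‖f‖ * ‖g‖) measurable_fg.aestronglyMeasurable <|
        ae_of_all _ fun p => norm_mul_le_of_le (f.norm_coe_le_norm _) (g.norm_coe_le_norm _)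
    rw [integral_withDensity hK, integral_withDensity hK.neg, ← sub_eq_zero,
      ← integral_sub (integrable_mul hK) (integrable_mul hK.neg)]
    simpa only [← mul_sub, Pi.neg_apply, max_zero_sub_max_neg_zero_eq_self] using h f g
  filter_upwards [(withDensity_eq_iff_of_sigmaFinite hK.1.aemeasurable.ennreal_ofReal
    hK.neg.1.aemeasurable.ennreal_ofReal).1 densities_eq] with p hp
  rcases le_total (K p) 0 with hneg | hpos
  · rw [ENNReal.ofReal_of_nonpos hneg, eq_comm, ENNReal.ofReal_eq_zero] at hp
    exact le_antisymm hneg (neg_nonpos.1 hp)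
  · rw [ENNReal.ofReal_of_nonpos (p := (-K) p) (neg_nonpos.2 hpos), ENNReal.ofReal_eq_zero] at hp
    exact le_antisymm hp hpos

theorem SymmKernel.expect_expect_mul_sample {V : Type} {Z : Type*} [Fintype V] [DecidableEq V]
    (W : SymmKernel) (f : Z × Z → ℝ) (π : Z → I) (z : V → Z) :
    𝔼 i, 𝔼 j, f (z i, z j) * W.sample (fun i => π (z i)) s(i, j) =
      offDiagMean (fun p => f p * W (π p.1) (π p.2)) z := by
  refine Finset.expect_congr rfl fun i _ => Finset.expect_congr rfl fun j _ => ?_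
  rcases eq_or_ne i j with rfl | hij
  · simp [SymmKernel.sample]
  · rw [if_neg hij, W.sample_mk_of_ne _ hij]

section TypicalLimit

variable {α : Type*} {l : Filter α} {V : α → Type} [∀ a, Fintype (V a)]

theorem tendsto_expect_expect_mul_of_tendsto_fourCycleDensity {d : ∀ a, V a → V a → ℝ}
    [∀ a, Nonempty (V a)] (hd : Tendsto (fun a => fourCycleDensity (d a)) l (𝓝 0))
    {f g : ∀ a, V a → ℝ} {A B : ℝ} (hf : ∀ a i, |f a i| ≤ A) (hg : ∀ a j, |g a j| ≤ B) :
    Tendsto (fun a => 𝔼 i, 𝔼 j, f a i * g a j * d a i j) l (𝓝 0) := by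
  have expect_sq_le {h : ∀ a, V a → ℝ} {C : ℝ} (hC : ∀ a i, |h a i| ≤ C) (a : α) :
      𝔼 i, h a i ^ 2 ≤ C ^ 2 :=
    Finset.expect_le Finset.univ_nonempty fun i _ => sq_le_sq' (abs_le.1 (hC a i)).1
      (abs_le.1 (hC a i)).2
  have bound (a : α) : (𝔼 i, 𝔼 j, f a i * g a j * d a i j) ^ 4 ≤
      (A ^ 2) ^ 2 * (B ^ 2) ^ 2 * fourCycleDensity (d a) := by
    refine (expect_bilinear_pow_four_le _ _ _).trans ?_
    gcongr
    exacts [fourCycleDensity_nonneg _, expect_sq_le hf a, expect_sq_le hg a]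
  have fourth_power : Tendsto (fun a => (𝔼 i, 𝔼 j, f a i * g a j * d a i j) ^ 4) l (𝓝 0) :=
    squeeze_zero (fun a => by positivity) bound (by simpa using hd.const_mul _)
  refine Metric.tendsto_nhds.2 fun e he => ?_
  filter_upwards [fourth_power.eventually_lt_const (pow_pos he 4)] with a ha
  rw [dist_zero_right]
  refine lt_of_pow_lt_pow_left₀ 4 he.le ?_
  rwa [Real.norm_eq_abs, (by decide : Even 4).pow_abs]

variable [∀ a, Nonempty (V a)] [∀ a, DecidableEq (V a)]
  {Z : Type*} [TopologicalSpace Z] [MeasurableSpace Z] [BorelSpace Z]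
  {z : ∀ a, V a → Z} {γ : ProbabilityMeasure Z} {π : Z → I}
  {W : SymmKernel} {P : ℕ → I × I →ᵇ ℝ} {S : α → Finset (I →ᵇ ℝ)} {δ : α → ℝ}
  {ε : ∀ a, Sym2 (V a) → ℤˣ}

theorem measurePreserving_of_isTypicalSample [l.NeBot]
    (hγ : Tendsto (fun a => empirical (z a)) l (𝓝 γ)) (hπ : Continuous π)
    (hz : ∀ a, IsTypicalSample (S a) (δ a) P W (ε a) fun i => π (z a i))
    (hS : ∀ f, ∀ᶠ a in l, f ∈ S a) (hδ : Tendsto δ l (𝓝 0)) :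
    MeasurePreserving π (γ : Measure Z) volume := by
  refine measurePreserving_of_tendsto_empirical hγ hπ fun f => ?_
  rw [tendsto_iff_norm_sub_tendsto_zero]
  exact squeeze_zero' (Eventually.of_forall fun _ => norm_nonneg _)
    ((hS f).mono fun a ha => ((hz a).average f ha).le) hδ

variable [SecondCountableTopology Z] [TopologicalSpace.PseudoMetrizableSpace Z]

theorem tendsto_expect_expect_mul_sample (hγ : Tendsto (fun a => empirical (z a)) l (𝓝 γ))
    (hcard : Tendsto (fun a => Fintype.card (V a)) l atTop) (hπc : Continuous π)
    (hπ : MeasurePreserving π (γ : Measure Z) volume)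
    (hm : Measurable fun p : I × I => W p.1 p.2) (hb : ∀ x y, |W x y| ≤ 1)
    (hP : ∀ k, ∫ p : I × I, |W p.1 p.2 - P k p| ≤ (1 / 2) ^ k)
    (hz : ∀ k a, offDiagMean (fun p => |W p.1 p.2 - P k p|) (fun i => π (z a i)) ≤ (1 / 2) ^ k)
    (f : Z × Z →ᵇ ℝ) :
    Tendsto (fun a => 𝔼 i, 𝔼 j, f (z a i, z a j) * W.sample (fun i => π (z a i)) s(i, j)) l
      (𝓝 (∫ p, f p * W (π p.1) (π p.2) ∂(γ : Measure Z).prod γ)) := by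
  have hππ : MeasurePreserving (Prod.map π π) ((γ : Measure Z).prod γ) volume := hπ.prod hπ
  have integrable_W : Integrable fun p : I × I => W p.1 p.2 :=
    Integrable.of_bound hm.aestronglyMeasurable 1 (ae_of_all _ fun p => hb p.1 p.2)
  have integrable_comp : Integrable (fun p : Z × Z => f p * W (π p.1) (π p.2))
      ((γ : Measure Z).prod γ) :=
    (hππ.integrable_comp_of_integrable integrable_W).bdd_mul (by fun_prop)
      (ae_of_all _ f.norm_coe_le_norm)
  let Q (k : ℕ) : Z × Z →ᵇ ℝ := f * (P k).compContinuous ⟨Prod.map π π, hπc.prodMap hπc⟩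
  have abs_sub_le (k : ℕ) (p : Z × Z) : |f p * W (π p.1) (π p.2) - Q k p| ≤
      ‖f‖ * |W (π p.1) (π p.2) - P k (π p.1, π p.2)| := by
    change |f p * _ - f p * _| ≤ _
    rw [← mul_sub, abs_mul]
    exact mul_le_mul_of_nonneg_right (f.norm_coe_le_norm p) (abs_nonneg _)
  simp only [W.expect_expect_mul_sample f π]
  refine tendsto_offDiagMean_of_approx hγ hcard integrable_comp (P := Q)
    (η := fun k => ‖f‖ * (1 / 2) ^ k) ?_ (fun k a => ?_) fun k => ?_
  · simpa using (tendsto_pow_atTop_nhds_zero_of_lt_one one_half_pos.le one_half_lt_one).const_mul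
      ‖f‖
  · refine le_trans ?_ (mul_le_mul_of_nonneg_left (hz k a) (norm_nonneg f))
    simp only [offDiagMean, Finset.mul_expect]
    refine Finset.expect_le_expect fun i _ => Finset.expect_le_expect fun j _ => ?_
    split_ifs
    exacts [(mul_zero _).ge, abs_sub_le k _]
  · have integrable_sub := (integrable_W.sub ((P k).integrable _)).abs
    calc _ ≤ ∫ p, ‖f‖ * |W (π p.1) (π p.2) - P k (π p.1, π p.2)| ∂(γ : Measure Z).prod γ :=
          integral_mono (integrable_comp.sub ((Q k).integrable _)).abs
            ((hππ.integrable_comp_of_integrable integrable_sub).const_mul _) (abs_sub_le k)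
      _ = ‖f‖ * ∫ p : I × I, |W p.1 p.2 - P k p| := by
          rw [integral_const_mul, ← hππ.map_eq, integral_map hππ.aemeasurable]
          · rfl
          · exact hππ.map_eq.symm ▸ integrable_sub.1
      _ ≤ _ := mul_le_mul_of_nonneg_left (hP k) (norm_nonneg f)

theorem tendsto_expect_expect_mul_sign (hγ : Tendsto (fun a => empirical (z a)) l (𝓝 γ))
    (hcard : Tendsto (fun a => Fintype.card (V a)) l atTop) (hπc : Continuous π)
    (hπ : MeasurePreserving π (γ : Measure Z) volume)
    (hm : Measurable fun p : I × I => W p.1 p.2) (hb : ∀ x y, |W x y| ≤ 1)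
    (hP : ∀ k, ∫ p : I × I, |W p.1 p.2 - P k p| ≤ (1 / 2) ^ k)
    (hz : ∀ a, IsTypicalSample (S a) (δ a) P W (ε a) fun i => π (z a i))
    (hδ : Tendsto δ l (𝓝 0)) (f g : Z →ᵇ ℝ) :
    Tendsto (fun a => 𝔼 i, 𝔼 j, f (z a i) * g (z a j) * (ε a s(i, j) : ℝ)) l
      (𝓝 (∫ p, f p.1 * g p.2 * W (π p.1) (π p.2) ∂(γ : Measure Z).prod γ)) := by
  have cut := tendsto_expect_expect_mul_of_tendsto_fourCycleDensity
    (squeeze_zero (fun a => fourCycleDensity_nonneg _) (fun a => (hz a).fourCycle.le) hδ)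
    (f := fun a i => f (z a i)) (g := fun a i => g (z a i)) (fun a i => f.norm_coe_le_norm _)
    fun a i => g.norm_coe_le_norm _
  have sample := tendsto_expect_expect_mul_sample hγ hcard hπc hπ hm hb hP
    (fun k a => ((hz a).approx k).le)
    (f.compContinuous ⟨Prod.fst, continuous_fst⟩ * g.compContinuous ⟨Prod.snd, continuous_snd⟩)
  have sum := cut.add sample
  rw [zero_add] at sum
  refine sum.congr fun a => ?_
  simp only [← Finset.expect_add_distrib]
  refine Finset.expect_congr rfl fun i _ => Finset.expect_congr rfl fun j _ => ?_
  change f (z a i) * g (z a j) * _ + f (z a i) * g (z a j) * _ = _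
  ring

end TypicalLimit

section CouplingExistence

variable {W W' : SymmKernel}

theorem kernelCoupling_of_isTypicalSample {α : Type*} {l : Filter α} [l.NeBot] {V : α → Type}
    [∀ a, Fintype (V a)] [∀ a, Nonempty (V a)] [∀ a, DecidableEq (V a)]
    {x y : ∀ a, V a → I} {γ : ProbabilityMeasure (I × I)} {P P' : ℕ → I × I →ᵇ ℝ}
    {S : α → Finset (I →ᵇ ℝ)} {δ : α → ℝ} {ε : ∀ a, Sym2 (V a) → ℤˣ}
    (hγ : Tendsto (fun a => empirical fun i => (x a i, y a i)) l (𝓝 γ))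
    (hcard : Tendsto (fun a => Fintype.card (V a)) l atTop)
    (hm : Measurable fun p : I × I => W p.1 p.2) (hm' : Measurable fun p : I × I => W' p.1 p.2)
    (hb : ∀ x y, |W x y| ≤ 1) (hb' : ∀ x y, |W' x y| ≤ 1)
    (hP : ∀ k, ∫ p : I × I, |W p.1 p.2 - P k p| ≤ (1 / 2) ^ k)
    (hP' : ∀ k, ∫ p : I × I, |W' p.1 p.2 - P' k p| ≤ (1 / 2) ^ k)
    (hx : ∀ a, IsTypicalSample (S a) (δ a) P W (ε a) (x a))
    (hy : ∀ a, IsTypicalSample (S a) (δ a) P' W' (ε a) (y a))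
    (hS : ∀ f, ∀ᶠ a in l, f ∈ S a) (hδ : Tendsto δ l (𝓝 0)) :
    KernelCoupling (γ : Measure (I × I)) Prod.fst Prod.snd W W' := by
  have left := measurePreserving_of_isTypicalSample hγ continuous_fst hx hS hδ
  have right := measurePreserving_of_isTypicalSample hγ continuous_snd hy hS hδ
  refine ⟨left, right, ?_⟩
  have integrable_mul {U : SymmKernel} (hU : Measurable fun p : I × I => U p.1 p.2)
      (hU1 : ∀ x y, |U x y| ≤ 1) {π : I × I → I}
      (hπ : MeasurePreserving π (γ : Measure (I × I)) volume) (f g : I × I →ᵇ ℝ) :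
      Integrable (fun p => f p.1 * g p.2 * U (π p.1) (π p.2)) ((γ : Measure (I × I)).prod γ) :=
    Integrable.of_bound (C := ‖f‖ * ‖g‖ * 1)
      ((by fun_prop : Measurable fun p : (I × I) × I × I => f p.1 * g p.2).mul
        (hU.comp (hπ.prod hπ).measurable)).aestronglyMeasurable <| ae_of_all _ fun p =>
      norm_mul_le_of_le (norm_mul_le_of_le (f.norm_coe_le_norm _) (g.norm_coe_le_norm _))
        (hU1 _ _)
  have difference_eq_zero := ae_eq_zero_of_integral_mul_mul_eq_zero
    (μ := (γ : Measure (I × I)).prod γ)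
    (K := fun p : (I × I) × I × I => W p.1.1 p.2.1 - W' p.1.2 p.2.2)
    (by simpa [Pi.sub_def] using
      (integrable_mul hm hb left 1 1).sub (integrable_mul hm' hb' right 1 1))
    fun f g => by
      simp only [mul_sub]
      rw [integral_sub (integrable_mul hm hb left f g) (integrable_mul hm' hb' right f g),
        sub_eq_zero]
      exact tendsto_nhds_unique
        (tendsto_expect_expect_mul_sign hγ hcard continuous_fst left hm hb hP hx hδ f g)
        (tendsto_expect_expect_mul_sign hγ hcard continuous_snd right hm' hb' hP' hy hδ f g)
  exact difference_eq_zero.mono fun p hp => sub_eq_zero.1 hp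

theorem exists_boundedContinuous_integral_abs_sub_le {X : Type*} [TopologicalSpace X]
    [NormalSpace X] [MeasurableSpace X] [BorelSpace X] {μ : Measure X} [μ.WeaklyRegular]
    {f : X → ℝ} (hf : Integrable f μ) {η : ℕ → ℝ} (hη : ∀ k, 0 < η k) :
    ∃ P : ℕ → X →ᵇ ℝ, ∀ k, ∫ x, |f x - P k x| ∂μ ≤ η k := by
  choose P hP using fun k => hf.exists_boundedContinuous_integral_sub_le (hη k)
  exact ⟨P, fun k => (hP k).1⟩

theorem exists_kernelCoupling_of_simpleDensity_eq_of_abs_le_one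
    (hm : Measurable fun p : I × I => W p.1 p.2) (hm' : Measurable fun p : I × I => W' p.1 p.2)
    (hb : ∀ x y, |W x y| ≤ 1) (hb' : ∀ x y, |W' x y| ≤ 1)
    (h : ∀ (n : ℕ) (F : SimpleGraph (Fin n)), simpleDensity F W' = simpleDensity F W) :
    ∃ γ : ProbabilityMeasure (I × I),
      KernelCoupling (γ : Measure (I × I)) Prod.fst Prod.snd W W' := by
  classical
  have approx {U : SymmKernel} (hU : Measurable fun p : I × I => U p.1 p.2)
      (hU1 : ∀ x y, |U x y| ≤ 1) :=
    exists_boundedContinuous_integral_abs_sub_le (η := fun k => (1 / 4) ^ k / 16)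
      (Integrable.of_bound (μ := (volume : Measure (I × I))) hU.aestronglyMeasurable 1
        (ae_of_all _ fun p => hU1 p.1 p.2)) fun k => by positivity
  obtain ⟨P, hP⟩ := approx hm hb
  obtain ⟨P', hP'⟩ := approx hm' hb'
  have rate_le (k : ℕ) : (1 / 4 : ℝ) ^ k / 16 ≤ (1 / 2) ^ k :=
    (div_le_self (by positivity) (by norm_num)).trans
      (pow_le_pow_left₀ (by norm_num) (by norm_num) k)
  choose n hn ε x y hx hy using fun a : Finset (I →ᵇ ℝ) × ℕ => exists_common_isTypicalSample
    hm hm' hb hb' hP hP' h a.1 (Nat.one_div_pos_of_nat (α := ℝ) (n := a.2)) a.2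
  let 𝒰 : Ultrafilter (Finset (I →ᵇ ℝ) × ℕ) := Ultrafilter.of atTop
  have h𝒰 : (𝒰 : Filter (Finset (I →ᵇ ℝ) × ℕ)) ≤ atTop := Ultrafilter.of_le _
  have snd_atTop : Tendsto (fun a : Finset (I →ᵇ ℝ) × ℕ => a.2) 𝒰 atTop :=
    (prod_atTop_atTop_eq (α := Finset (I →ᵇ ℝ)) (β := ℕ) ▸ tendsto_snd :
      Tendsto _ atTop atTop).mono_left h𝒰
  obtain ⟨γ, -, hγ⟩ := isCompact_univ.ultrafilter_le_nhds
    (𝒰.map fun a => empirical fun i => (x a i, y a i)) (by simp)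
  refine ⟨γ, kernelCoupling_of_isTypicalSample hγ ?_ hm hm' hb hb'
    (fun k => (hP k).trans (rate_le k)) (fun k => (hP' k).trans (rate_le k)) hx hy (fun f => ?_)
    (tendsto_one_div_add_atTop_nhds_zero_nat.comp snd_atTop)⟩
  · simp only [Fintype.card_fin]
    exact tendsto_atTop_mono (fun a => (hn a).trans (Nat.le_succ _)) snd_atTop
  · filter_upwards [h𝒰 (eventually_ge_atTop ({f}, 0))] with a ha
    exact ha.1 (Finset.mem_singleton_self f)

/-- The kernel `c • W`, for rescaling kernels to values in `[-1, 1]`, where they are the means of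
random signs. -/
def SymmKernel.scale (c : ℝ) (W : SymmKernel) : SymmKernel where
  toFun x y := c * W x y
  symm' x y := by rw [W.symm']
  bounded' := W.bounded'.imp' (|c| * ·) fun C hC x y => by
    rw [abs_mul]
    exact mul_le_mul_of_nonneg_left (hC x y) (abs_nonneg c)
  measurable' := (measurable_const_mul c).comp_nullMeasurable W.measurable'

open Classical in
theorem simpleDensity_scale {V : Type} [Fintype V] (c : ℝ) (W : SymmKernel) (F : SimpleGraph V) :
    simpleDensity F (W.scale c) = c ^ F.edgeFinset.card * simpleDensity F W := by
  unfold simpleDensity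
  rw [← integral_const_mul]
  refine integral_congr_ae (ae_of_all _ fun x => ?_)
  simp only [← Finset.prod_const, ← Finset.prod_mul_distrib]
  refine Finset.prod_congr rfl fun e _ => ?_
  induction e with
  | h i j => rfl

theorem simpleDensity_congr_aeEqSquare (h : AEEqSquare W W') {V : Type} [Fintype V]
    (F : SimpleGraph V) : simpleDensity F W = simpleDensity F W' := by
  have coupling : KernelCoupling volume id id W W' := ⟨.id _, .id _, h⟩
  simpa only [multiDensity_ofSimpleGraph] using coupling.multiDensity_eq (.ofSimpleGraph F)

theorem exists_kernelCoupling_of_simpleDensity_eq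
    (h : ∀ (n : ℕ) (F : SimpleGraph (Fin n)), simpleDensity F W' = simpleDensity F W) :
    ∃ γ : ProbabilityMeasure (I × I),
      KernelCoupling (γ : Measure (I × I)) Prod.fst Prod.snd W W' := by
  obtain ⟨C, hC⟩ := W.bounded'
  obtain ⟨C', hC'⟩ := W'.bounded'
  obtain ⟨V, hVm, hVb, hV⟩ := W.exists_borel hC
  obtain ⟨V', hVm', hVb', hV'⟩ := W'.exists_borel hC'
  have hC_nonneg : 0 ≤ C := (abs_nonneg _).trans (hC 0 0)
  have hC'_nonneg : 0 ≤ C' := (abs_nonneg _).trans (hC' 0 0)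
  let c : ℝ := (C + C' + 1)⁻¹
  have hc : 0 < c := by positivity
  have abs_le_one {t : ℝ} (ht : |t| ≤ C + C') : |c * t| ≤ 1 := by
    rw [abs_mul, abs_of_pos hc, inv_mul_le_iff₀ (by positivity)]
    linarith
  obtain ⟨γ, hγ⟩ := exists_kernelCoupling_of_simpleDensity_eq_of_abs_le_one
    (W := V.scale c) (W' := V'.scale c) (hVm.const_mul c) (hVm'.const_mul c)
    (fun x y => abs_le_one ((hVb x y).trans (le_add_of_nonneg_right hC'_nonneg)))
    (fun x y => abs_le_one ((hVb' x y).trans (le_add_of_nonneg_left hC_nonneg)))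
    (fun n F => by
      rw [simpleDensity_scale, simpleDensity_scale, ← simpleDensity_congr_aeEqSquare hV,
        ← simpleDensity_congr_aeEqSquare hV', h])
  have unscaled : KernelCoupling (γ : Measure (I × I)) Prod.fst Prod.snd V V' :=
    ⟨hγ.left, hγ.right, hγ.ae_eq.mono fun p hp => mul_left_cancel₀ hc.ne' hp⟩
  exact ⟨γ, unscaled.congr_kernels (hV.mono fun p hp => hp.symm) (hV'.mono fun p hp => hp.symm)⟩

end CouplingExistence

section Rank

variable {T : Type*} [LinearOrder T] [MeasurableSpace T] {m : Measure T}

theorem measure_eq_zero_of_forall_measure_inter_Iic_eq_zero [SFinite m]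
    (hle : MeasurableSet {p : T × T | p.1 ≤ p.2}) {E : Set T} (hE : MeasurableSet E)
    (h : ∀ t ∈ E, m (E ∩ Set.Iic t) = 0) : m E = 0 := by
  let A : Set (T × T) := {p | p.1 ∈ E ∧ p.2 ∈ E ∧ p.2 ≤ p.1}
  have measurable_A : MeasurableSet A :=
    (measurable_fst hE).inter ((measurable_snd hE).inter (measurable_swap hle))
  have null_A : (m.prod m) A = 0 := by
    refine (Measure.measure_prod_null measurable_A).2 (ae_of_all _ fun t => ?_)
    by_cases ht : t ∈ E
    · exact measure_mono_null (t := E ∩ Set.Iic t) (fun s hs => ⟨hs.2.1, hs.2.2⟩) (h t ht)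
    · exact measure_mono_null (t := ∅) (fun s hs => ht hs.1) measure_empty
  have null_swap_A : (m.prod m) (Prod.swap ⁻¹' A) = 0 := by
    rw [Measure.measurePreserving_swap.measure_preimage measurable_A.nullMeasurableSet, null_A]
  have square_subset : E ×ˢ E ⊆ A ∪ Prod.swap ⁻¹' A := fun p hp =>
    (le_total p.2 p.1).imp (fun hle => ⟨hp.1, hp.2, hle⟩) fun hle => ⟨hp.2, hp.1, hle⟩
  have null_square := measure_mono_null square_subset (measure_union_null null_A null_swap_A)
  rwa [Measure.prod_prod, mul_self_eq_zero] at null_square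

theorem measure_setOf_measure_Iic_le_le [IsFiniteMeasure m]
    (hle : MeasurableSet {p : T × T | p.1 ≤ p.2}) (c : ℝ≥0∞) :
    m {t | m (Set.Iic t) ≤ c} ≤ c := by
  have measurable_Iic (t : T) : MeasurableSet (Set.Iic t) := measurable_prodMk_right hle
  let S := {t | m (Set.Iic t) ≤ c}
  have measurable_S : MeasurableSet S :=
    measurableSet_le (measurable_measure_prodMk_right hle) measurable_const
  obtain hS | hS := S.eq_empty_or_nonempty
  · exact (congrArg m hS).trans_le (by simp)
  obtain ⟨u, -, hu, huS⟩ := exists_seq_tendsto_sSup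
    (hS.image fun t => m (Set.Iic t)) (OrderTop.bddAbove _)
  choose t htS htu using huS
  let L := ⋃ n, Set.Iic (t n)
  have measurable_L : MeasurableSet L := .iUnion fun n => measurable_Iic _
  have measure_L_le : m L ≤ c := by
    have directed : Directed (· ⊆ ·) fun n => Set.Iic (t n) :=
      Directed.mono_comp (g := Set.Iic) (· ≤ ·) (fun _ _ => Set.Iic_subset_Iic.2)
        (Std.Total.directed t)
    rw [directed.measure_iUnion]
    exact iSup_le htS
  have null_sdiff : m (S \ L) = 0 := by
    refine measure_eq_zero_of_forall_measure_inter_Iic_eq_zero hle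
      (measurable_S.diff measurable_L) fun s hs => ?_
    have L_subset : L ⊆ Set.Iic s := Set.iUnion_subset fun n => Set.Iic_subset_Iic.2 <|
      le_of_not_ge fun hst => hs.2 (Set.mem_iUnion.2 ⟨n, hst⟩)
    have measure_Iic_le : m (Set.Iic s) ≤ m L :=
      (le_sSup (Set.mem_image_of_mem _ hs.1)).trans <| le_of_tendsto' hu fun n =>
        (htu n).symm.trans_le (measure_mono (Set.subset_iUnion (fun n => Set.Iic (t n)) n))
    refine measure_mono_null (t := Set.Iic s \ L) (fun r hr => ⟨hr.2, hr.1.2⟩) ?_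
    rw [measure_sdiff L_subset measurable_L.nullMeasurableSet (measure_ne_top _ _),
      tsub_eq_zero_of_le measure_Iic_le]
  calc m S ≤ m L + m (S \ L) :=
        (measure_mono (Set.union_sdiff_self.symm ▸ Set.subset_union_right)).trans
          (measure_union_le _ _)
    _ ≤ c := by rwa [null_sdiff, add_zero]

variable [IsProbabilityMeasure m]

theorem measure_setOf_measure_Iic_le [NullSingletonClass m]
    (hle : MeasurableSet {p : T × T | p.1 ≤ p.2}) {c : ℝ≥0∞} (hc : c ≤ 1) :
    m {t | m (Set.Iic t) ≤ c} = c := by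
  refine (measure_setOf_measure_Iic_le_le hle c).antisymm ?_
  have measurable_S : MeasurableSet {t | m (Set.Iic t) ≤ c} :=
    measurableSet_le (measurable_measure_prodMk_right hle) measurable_const
  have measure_Ici (t : T) : m (Set.Ici t) = 1 - m (Set.Iic t) := by
    have measurable_Iic : MeasurableSet (Set.Iic t) := measurable_prodMk_right hle
    rw [← prob_compl_eq_one_sub measurable_Iic, Set.compl_Iic]
    exact (measure_congr Ioi_ae_eq_Ici).symm
  have : IsFiniteMeasure (α := Tᵒᵈ) m := inferInstanceAs (IsFiniteMeasure m)
  have measure_compl_le : m {t | m (Set.Iic t) ≤ c}ᶜ ≤ 1 - c :=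
    calc m {t | m (Set.Iic t) ≤ c}ᶜ ≤ m {t | m (Set.Ici t) ≤ 1 - c} :=
          measure_mono fun t (ht : ¬ m (Set.Iic t) ≤ c) =>
            (measure_Ici t).trans_le (tsub_le_tsub_left (le_of_not_ge ht) 1)
      _ ≤ 1 - c := measure_setOf_measure_Iic_le_le (T := Tᵒᵈ) (measurable_swap hle) _
  rw [prob_compl_eq_one_sub measurable_S] at measure_compl_le
  exact (ENNReal.sub_le_sub_iff_left hc ENNReal.one_ne_top).1 measure_compl_le

variable (m) in
/-- The distribution function `t ↦ m (-∞, t]` of a probability measure on a linear order, as a map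
into the unit interval. -/
noncomputable def orderCDF (t : T) : I :=
  ⟨m.real (Set.Iic t), measureReal_nonneg, measureReal_le_one⟩

theorem orderCDF_mono : Monotone (orderCDF m) := fun _ _ h =>
  measureReal_mono (Set.Iic_subset_Iic.2 h)

theorem measurePreserving_orderCDF [NullSingletonClass m]
    (hle : MeasurableSet {p : T × T | p.1 ≤ p.2}) :
    MeasurePreserving (orderCDF m) m volume := by
  have measurable_orderCDF : Measurable (orderCDF m) :=
    (measurable_measure_prodMk_right hle).ennreal_toReal.subtype_mk
  have := Measure.isProbabilityMeasure_map (μ := m) measurable_orderCDF.aemeasurable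
  refine ⟨measurable_orderCDF, Measure.ext_of_Iic _ _ fun c => ?_⟩
  rw [Measure.map_apply measurable_orderCDF measurableSet_Iic, unitInterval.volume_Iic,
    ← measure_setOf_measure_Iic_le (m := m) hle (ENNReal.ofReal_le_one.2 c.2.2)]
  refine congrArg m (Set.ext fun t => ?_)
  exact (ENNReal.le_ofReal_iff_toReal_le (measure_ne_top _ _) c.2.1).symm

end Rank

section Quantile

variable {Ω : Type*} [MeasurableSpace Ω] {μ : Measure Ω} {ν : Measure I} [IsProbabilityMeasure ν]

variable (ν) in
/-- The quantile function of a probability measure on the unit interval: the generalized inverse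
of its distribution function. -/
noncomputable def quantile (u : I) : I := sInf {s | u ≤ orderCDF ν s}

theorem measurable_quantile : Measurable (quantile ν) :=
  Monotone.measurable fun _ _ h => sInf_le_sInf fun _ hs => h.trans hs

theorem ae_le_iff_le_orderCDF {φ ρ : Ω → I} (hφ : MeasurePreserving φ μ ν)
    (hρ : MeasurePreserving ρ μ volume) (h : ∀ x, ρ x ≤ orderCDF ν (φ x)) (s : I) :
    ∀ᵐ x ∂μ, φ x ≤ s ↔ ρ x ≤ orderCDF ν s := by
  have subset : φ ⁻¹' Set.Iic s ⊆ ρ ⁻¹' Set.Iic (orderCDF ν s) := fun x hx =>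
    (h x).trans (orderCDF_mono hx)
  have measure_eq : μ (ρ ⁻¹' Set.Iic (orderCDF ν s)) = μ (φ ⁻¹' Set.Iic s) := by
    rw [hρ.measure_preimage measurableSet_Iic.nullMeasurableSet,
      hφ.measure_preimage measurableSet_Iic.nullMeasurableSet, unitInterval.volume_Iic]
    exact ofReal_measureReal
  have ae_eq := ae_eq_of_subset_of_measure_ge subset measure_eq.le
    (hφ.measurable measurableSet_Iic).nullMeasurableSet
    (by rw [hρ.measure_preimage measurableSet_Iic.nullMeasurableSet]; exact measure_ne_top _ _)
  exact ae_eq.mono fun x hx => iff_of_eq hx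

theorem ae_quantile_eq {φ ρ : Ω → I} (hφ : MeasurePreserving φ μ ν)
    (hρ : MeasurePreserving ρ μ volume) (h : ∀ x, ρ x ≤ orderCDF ν (φ x)) :
    ∀ᵐ x ∂μ, quantile ν (ρ x) = φ x := by
  obtain ⟨D, hD, hDense⟩ := TopologicalSpace.exists_countable_dense I
  filter_upwards [(ae_ball_iff hD).2 fun s _ => ae_le_iff_le_orderCDF hφ hρ h s] with x hx
  refine le_antisymm (sInf_le (h x)) (le_sInf fun s hs => le_of_not_gt fun hsx => ?_)
  obtain ⟨d, hdD, hsd, hdx⟩ := hDense.exists_between hsx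
  exact hdx.not_ge ((hx d hdD).2 (hs.trans (orderCDF_mono hsd.le)))

local instance : MeasurableSpace (I ×ₗ I) := inferInstanceAs (MeasurableSpace (I × I))

/- Ranking the points `x` by `φ x` and breaking ties by `x` itself leaves no atoms, so that the rank
is uniformly distributed even where `φ` is constant on a set of positive measure. -/
theorem exists_measurePreserving_ae_quantile_eq {φ : I → I} (hφ : MeasurePreserving φ volume ν) :
    ∃ ρ : I → I, MeasurePreserving ρ volume volume ∧ ∀ᵐ x, quantile ν (ρ x) = φ x := by
  let lex (x : I) : I ×ₗ I := toLex (φ x, x)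
  have measurable_lex : Measurable lex := hφ.measurable.prodMk measurable_id
  have measurable_le : MeasurableSet {p : (I ×ₗ I) × (I ×ₗ I) | p.1 ≤ p.2} := by
    have measurable_ofLex : Measurable (ofLex : I ×ₗ I → I × I) := measurable_id
    simp only [Prod.Lex.le_iff]
    measurability
  let m : Measure (I ×ₗ I) := volume.map lex
  have : IsProbabilityMeasure m := Measure.isProbabilityMeasure_map measurable_lex.aemeasurable
  have : NullSingletonClass m := ⟨fun p => by
    refine (Measure.map_apply measurable_lex (measurableSet_singleton (α := I × I) p)).trans ?_
    exact measure_mono_null (t := {(ofLex p).2})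
      (fun x (hx : lex x = p) => congrArg (fun q : I ×ₗ I => (ofLex q).2) hx)
      (measure_singleton _)⟩
  have hρ := (measurePreserving_orderCDF (m := m) measurable_le).comp
    (⟨measurable_lex, rfl⟩ : MeasurePreserving lex volume m)
  refine ⟨orderCDF m ∘ lex, hρ, ae_quantile_eq hφ hρ fun x => ?_⟩
  have measurable_Iic : MeasurableSet (Set.Iic (lex x)) := measurable_prodMk_right measurable_le
  have measure_Iic_le : m (Set.Iic (lex x)) ≤ ν (Set.Iic (φ x)) := by
    rw [Measure.map_apply measurable_lex measurable_Iic,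
      ← hφ.measure_preimage measurableSet_Iic.nullMeasurableSet]
    exact measure_mono fun t ht => Prod.Lex.monotone_fst _ _ ht
  exact ENNReal.toReal_mono (measure_ne_top _ _) measure_Iic_le

end Quantile

section Factor

open ProbabilityTheory

variable {Ω T : Type*} [MeasurableSpace Ω] [StandardBorelSpace Ω] [Nonempty Ω] [MeasurableSpace T]
  {μ : Measure Ω} [IsFiniteMeasure μ] {φ : Ω → T}

theorem ae_ae_condDistrib_id (hφ : Measurable φ) {p : T × Ω → Prop} (hp : MeasurableSet {q | p q})
    (h : ∀ᵐ x ∂μ, p (φ x, x)) : ∀ᵐ x ∂μ, ∀ᵐ a ∂condDistrib id φ μ (φ x), p (φ x, a) := by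
  have ae_joint : ∀ᵐ q ∂μ.map φ ⊗ₘ condDistrib id φ μ, p q := by
    rw [compProd_map_condDistrib aemeasurable_id,
      ae_map_iff (hφ.prodMk measurable_id).aemeasurable hp]
    exact h
  exact ae_of_ae_map hφ.aemeasurable (Measure.ae_ae_of_ae_compProd ae_joint)

theorem ae_ae_eq_integral_condDistrib [MeasurableEq T] {Y : Type*} [MeasurableSpace Y]
    {ν : Measure Y} [SFinite ν] (hφ : Measurable φ) {W : Ω → Y → ℝ}
    (hW : Measurable fun p : Ω × Y => W p.1 p.2)
    (h : ∀ x x', φ x = φ x' → ∀ᵐ y ∂ν, W x y = W x' y) :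
    ∀ᵐ y ∂ν, ∀ᵐ x ∂μ, W x y = ∫ a, W a y ∂condDistrib id φ μ (φ x) := by
  have same_fibre : ∀ᵐ x ∂μ, ∀ᵐ a ∂condDistrib id φ μ (φ x), φ x = φ a :=
    ae_ae_condDistrib_id (p := fun q => q.1 = φ q.2) hφ
      (measurableSet_eq_fun measurable_fst (hφ.comp measurable_snd)) (ae_of_all _ fun _ => rfl)
  have joint : ∀ᵐ q ∂μ ⊗ₘ (condDistrib id φ μ).comap φ hφ, ∀ᵐ y ∂ν, W q.1 y = W q.2 y :=
    (Measure.ae_compProd_of_ae_ae (p := fun q : Ω × Ω => φ q.1 = φ q.2)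
      (measurableSet_eq_fun (hφ.comp measurable_fst) (hφ.comp measurable_snd))
      (by simpa only [Kernel.comap_apply] using same_fibre)).mono fun q hq => h _ _ hq
  have measurable_eq : MeasurableSet {q : (Ω × Ω) × Y | W q.1.1 q.2 = W q.1.2 q.2} :=
    measurableSet_eq_fun (by fun_prop) (by fun_prop)
  have swapped : ∀ᵐ y ∂ν, ∀ᵐ q ∂μ ⊗ₘ (condDistrib id φ μ).comap φ hφ, W q.1 y = W q.2 y :=
    (Measure.ae_ae_comm (p := fun (q : Ω × Ω) y => W q.1 y = W q.2 y) measurable_eq).1 joint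
  filter_upwards [swapped] with y hy
  filter_upwards [Measure.ae_ae_of_ae_compProd hy] with x hx
  rw [Kernel.comap_apply] at hx
  rw [← integral_congr_ae hx, integral_const, probReal_univ, one_smul]

theorem exists_factor_of_ae_eq_on_fibres [MeasurableEq T] (hφ : Measurable φ) {W : Ω → Ω → ℝ}
    (hW : Measurable fun p : Ω × Ω => W p.1 p.2) (hsymm : ∀ x y, W x y = W y x) {C : ℝ}
    (hC : ∀ x y, |W x y| ≤ C) (h : ∀ x x', φ x = φ x' → ∀ᵐ y ∂μ, W x y = W x' y) :
    ∃ U : T → T → ℝ, (Measurable fun p : T × T => U p.1 p.2) ∧ (∀ s t, U s t = U t s) ∧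
      (∀ s t, |U s t| ≤ C) ∧ ∀ᵐ p ∂μ.prod μ, W p.1 p.2 = U (φ p.1) (φ p.2) := by
  let κ := condDistrib id φ μ
  let V (s : T) (y : Ω) : ℝ := ∫ a, W a y ∂κ s
  let U (s t : T) : ℝ := ∫ b, V s b ∂κ t
  have measurable_V : Measurable fun p : T × Ω => V p.1 p.2 :=
    (StronglyMeasurable.integral_kernel_prod_right (κ := κ.prodMkRight Ω)
      (f := fun p a => W a p.2) (by unfold Function.uncurry; fun_prop)).measurable
  have measurable_U : Measurable fun p : T × T => U p.1 p.2 :=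
    (StronglyMeasurable.integral_kernel_prod_right (κ := κ.prodMkLeft T)
      (f := fun p b => V p.1 b) (by unfold Function.uncurry; fun_prop)).measurable
  have V_le (s : T) (y : Ω) : |V s y| ≤ C := by
    simpa using norm_integral_le_of_norm_le_const (f := (W · y)) (ae_of_all (κ s) fun a => hC a y)
  refine ⟨U, measurable_U, fun s t => ?_, fun s t => ?_, ?_⟩
  · have integrable_W : Integrable (fun p : Ω × Ω => W p.1 p.2) ((κ t).prod (κ s)) :=
      Integrable.of_bound hW.aestronglyMeasurable C (ae_of_all _ fun p => hC p.1 p.2)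
    refine (integral_integral_swap (f := fun b a => W a b) ?_).trans ?_
    · simpa only [Function.uncurry_def, hsymm] using integrable_W
    · simp only [U, V, hsymm]
  · simpa using norm_integral_le_of_norm_le_const (f := V s) (ae_of_all (κ t) fun b => V_le s b)
  have W_eq_V : ∀ᵐ x ∂μ, ∀ᵐ y ∂μ, W x y = V (φ x) y :=
    (Measure.ae_ae_comm (p := fun x y => W x y = V (φ x) y) <|
      measurableSet_eq_fun (by fun_prop) (by fun_prop)).2 <| ae_ae_eq_integral_condDistrib hφ hW h
  have W_eq_integral : ∀ᵐ x ∂μ, ∀ᵐ y ∂μ, W x y = ∫ b, W x b ∂κ (φ y) := by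
    simpa only [hsymm] using ae_ae_eq_integral_condDistrib hφ hW h
  refine (Measure.ae_prod_iff_ae_ae <| measurableSet_eq_fun (by fun_prop) (by fun_prop)).2 ?_
  filter_upwards [W_eq_V, W_eq_integral] with x hV hint
  have V_on_fibres : ∀ᵐ y ∂μ, ∀ᵐ b ∂κ (φ y), W x b = V (φ x) b :=
    ae_ae_condDistrib_id (p := fun q => W x q.2 = V (φ x) q.2) hφ
      (measurableSet_eq_fun (by fun_prop) (by fun_prop)) hV
  filter_upwards [hint, V_on_fibres] with y hy hb
  exact hy.trans (integral_congr_ae hb)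

end Factor

section DeterminingSets

variable {α : Type*} [MeasurableSpace α] {μ : Measure α}

theorem ae_eq_of_forall_setIntegral_eq_of_isSetAlgebra {𝓐 : Set (Set α)} (h𝓐 : IsSetAlgebra 𝓐)
    (hgen : ‹MeasurableSpace α› = MeasurableSpace.generateFrom 𝓐) {f g : α → ℝ}
    (hf : Integrable f μ) (hg : Integrable g μ)
    (h : ∀ s ∈ 𝓐, ∫ x in s, f x ∂μ = ∫ x in s, g x ∂μ) : f =ᵐ[μ] g := by
  have integral_eq : ∫ x, f x ∂μ = ∫ x, g x ∂μ := by simpa using h _ h𝓐.univ_mem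
  have setIntegral_eq (s : Set α) (hs : MeasurableSet s) :
      ∫ x in s, f x ∂μ = ∫ x in s, g x ∂μ := by
    induction s, hs using MeasurableSpace.induction_on_inter hgen
      fun s hs t ht _ => h𝓐.inter_mem hs ht with
    | empty => simp only [Measure.restrict_empty, integral_zero_measure]
    | basic s hs => exact h s hs
    | compl s hs ih => rw [setIntegral_compl hs hf, setIntegral_compl hs hg, ih, integral_eq]
    | iUnion s hdisj hs ih =>
      rw [integral_iUnion hs hdisj hf.integrableOn, integral_iUnion hs hdisj hg.integrableOn]
      exact tsum_congr ih
  exact hf.ae_eq_of_forall_setIntegral_eq f g hg fun s hs _ => setIntegral_eq s hs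

variable (μ) in
theorem exists_seq_measurableSet_ae_eq_of_setIntegral_eq
    [MeasurableSpace.CountablyGenerated α] :
    ∃ B : ℕ → Set α, (∀ k, MeasurableSet (B k)) ∧ ∀ f g : α → ℝ, Integrable f μ → Integrable g μ →
      (∀ k, ∫ x in B k, f x ∂μ = ∫ x in B k, g x ∂μ) → f =ᵐ[μ] g := by
  let 𝓐 := generateSetAlgebra (MeasurableSpace.countableGeneratingSet α)
  have algebra : IsSetAlgebra 𝓐 := isSetAlgebra_generateSetAlgebra
  have generates : ‹MeasurableSpace α› = MeasurableSpace.generateFrom 𝓐 :=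
    (generateFrom_generateSetAlgebra_eq.trans
      MeasurableSpace.generateFrom_countableGeneratingSet).symm
  obtain ⟨B, hB⟩ := (countable_generateSetAlgebra
    MeasurableSpace.countable_countableGeneratingSet).exists_eq_range ⟨_, algebra.univ_mem⟩
  have mem_algebra (k : ℕ) : B k ∈ 𝓐 := (congrArg (B k ∈ ·) hB).mpr (Set.mem_range_self k)
  refine ⟨B, fun k => ?_, fun f g hf hg h => ?_⟩
  · rw [generates]
    exact MeasurableSpace.measurableSet_generateFrom (mem_algebra k)
  · refine ae_eq_of_forall_setIntegral_eq_of_isSetAlgebra algebra generates hf hg fun s hs => ?_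
    obtain ⟨k, rfl⟩ := (congrArg (s ∈ ·) hB).mp hs
    exact h k

end DeterminingSets

section CommonFactor

variable {Ω : Type*} [MeasurableSpace Ω] {γ : Measure Ω} {X Y Z : Ω → I} {W W' : I → I → ℝ}
  {B : ℕ → Set I}

/-- The integrals of the section `W x` along `Z` over the events `X ∈ B k`. If `X` and `Y` couple
`W` with `W'`, the profile of `W` along `X` at the point `X z` agrees with the profile of `W'`
along `Y` at `Y z`, because the events only refer to `X`. -/
noncomputable def profile (γ : Measure Ω) (X Z : Ω → I) (B : ℕ → Set I) (W : I → I → ℝ) (x : I)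
    (k : ℕ) : ℝ :=
  ∫ z in X ⁻¹' B k, W x (Z z) ∂γ

theorem measurable_profile [SFinite γ] (hZ : Measurable Z)
    (hW : Measurable fun p : I × I => W p.1 p.2) : Measurable (profile γ X Z B W) :=
  measurable_pi_iff.2 fun k => (StronglyMeasurable.integral_prod_right (ν := γ.restrict (X ⁻¹' B k))
    (f := fun x z => W x (Z z)) (by unfold Function.uncurry; fun_prop)).measurable

theorem KernelCoupling.ae_profile_eq [SFinite γ] (h : KernelCoupling γ X Y W W') :
    ∀ᵐ z ∂γ, profile γ X X B W (X z) = profile γ X Y B W' (Y z) := by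
  filter_upwards [Measure.ae_ae_of_ae_prod h.ae_eq] with z hz
  exact funext fun k => integral_congr_ae (ae_restrict_of_ae hz)

theorem profile_self_eq_setIntegral (hX : MeasurePreserving X γ volume)
    (hW : Measurable fun p : I × I => W p.1 p.2) (hB : ∀ k, MeasurableSet (B k)) (x : I) (k : ℕ) :
    profile γ X X B W x k = ∫ y in B k, W x y := by
  have measurable_section : Measurable (W x) := hW.comp measurable_prodMk_left
  rw [← hX.map_eq, setIntegral_map (hB k) measurable_section.aestronglyMeasurable
    hX.measurable.aemeasurable, profile]

theorem aeEqSquare_of_ae_comp [SFinite γ] (hX : MeasurePreserving X γ volume)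
    (hW : Measurable fun p : I × I => W p.1 p.2) (hW' : Measurable fun p : I × I => W' p.1 p.2)
    (h : ∀ᵐ p ∂γ.prod γ, W (X p.1) (X p.2) = W' (X p.1) (X p.2)) : AEEqSquare W W' := by
  have law := (hX.prod hX).map_eq
  rw [AEEqSquare, Measure.volume_eq_prod, ← law, ae_map_iff (hX.prod hX).aemeasurable
    (measurableSet_eq_fun hW hW')]
  exact h

/- Points with the same profile have almost everywhere equal sections, so both kernels factor
through their profiles, and the two profiles have the same law. -/
theorem KernelCoupling.exists_common_factor [IsProbabilityMeasure γ] {W W' : SymmKernel}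
    (h : KernelCoupling γ X Y W W') (hW : Measurable fun p : I × I => W p.1 p.2)
    (hW' : Measurable fun p : I × I => W' p.1 p.2) :
    ∃ (ν : Measure I) (φ ψ : I → I) (U : SymmKernel), MeasurePreserving φ volume ν ∧
      MeasurePreserving ψ volume ν ∧ (Measurable fun p : I × I => U p.1 p.2) ∧
      AEEqSquare W (pullback U φ) ∧ AEEqSquare W' (pullback U ψ) := by
  obtain ⟨C, hC⟩ := W.bounded'
  obtain ⟨B, hB, determining⟩ :=
    exists_seq_measurableSet_ae_eq_of_setIntegral_eq (volume : Measure I)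
  have embedding := measurableEmbedding_sigmoid_comp_embeddingReal (ℕ → ℝ)
  let φ := (unitInterval.sigmoid ∘ embeddingReal (ℕ → ℝ)) ∘ profile γ X X B W
  let ψ := (unitInterval.sigmoid ∘ embeddingReal (ℕ → ℝ)) ∘ profile γ X Y B W'
  have measurable_φ : Measurable φ :=
    embedding.measurable.comp (measurable_profile h.left.measurable hW)
  have measurable_ψ : Measurable ψ :=
    embedding.measurable.comp (measurable_profile h.right.measurable hW')
  have φ_eq_ψ : ∀ᵐ z ∂γ, φ (X z) = ψ (Y z) := h.ae_profile_eq.mono fun z hz =>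
    congrArg (unitInterval.sigmoid ∘ embeddingReal (ℕ → ℝ)) hz
  have law_eq : volume.map ψ = volume.map φ := by
    rw [← h.left.map_eq, Measure.map_map measurable_φ h.left.measurable, h.left.map_eq,
      ← h.right.map_eq, Measure.map_map measurable_ψ h.right.measurable]
    exact Measure.map_congr (φ_eq_ψ.mono fun z hz => hz.symm)
  have sections_eq (x x' : I) (hx : φ x = φ x') : ∀ᵐ y, W x y = W x' y := by
    have integrable_section (x : I) : Integrable (W x) :=
      Integrable.of_bound (hW.comp measurable_prodMk_left).aestronglyMeasurable C
        (ae_of_all _ (hC x))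
    refine determining _ _ (integrable_section x) (integrable_section x') fun k => ?_
    simp only [← profile_self_eq_setIntegral h.left hW hB, embedding.injective hx]
  obtain ⟨U, measurable_U, symm_U, U_le, hU⟩ :=
    exists_factor_of_ae_eq_on_fibres measurable_φ hW W.symm' hC sections_eq
  refine ⟨_, φ, ψ, ⟨U, symm_U, ⟨C, U_le⟩, measurable_U.nullMeasurable⟩, ⟨measurable_φ, rfl⟩,
    ⟨measurable_ψ, law_eq⟩, measurable_U, hU, ?_⟩
  have transported : ∀ᵐ p ∂γ.prod γ, W' (Y p.1) (Y p.2) = U (ψ (Y p.1)) (ψ (Y p.2)) := by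
    filter_upwards [h.ae_eq, (h.left.prod h.left).quasiMeasurePreserving.ae hU,
      Measure.quasiMeasurePreserving_fst.ae φ_eq_ψ, Measure.quasiMeasurePreserving_snd.ae φ_eq_ψ]
      with p hp hUp h₁ h₂
    rw [← hp, ← h₁, ← h₂]
    exact hUp
  exact aeEqSquare_of_ae_comp h.right hW'
    (measurable_U.comp (measurable_ψ.prodMap measurable_ψ)) transported

theorem AEEqSquare.trans {W₁ W₂ W₃ : I → I → ℝ} (h₁₂ : AEEqSquare W₁ W₂) (h₂₃ : AEEqSquare W₂ W₃) :
    AEEqSquare W₁ W₃ := by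
  filter_upwards [h₁₂, h₂₃] with p h h'
  exact h.trans h'

theorem aeEqSquare_pullback_quantile {ν : Measure I} [IsProbabilityMeasure ν] (U : I → I → ℝ)
    {φ ρ : I → I} (h : ∀ᵐ x, quantile ν (ρ x) = φ x) :
    AEEqSquare (pullback U φ) (pullback (pullback U (quantile ν)) ρ) := by
  filter_upwards [Measure.quasiMeasurePreserving_fst.ae h,
    Measure.quasiMeasurePreserving_snd.ae h] with p h₁ h₂
  simp only [pullback, h₁, h₂]

theorem KernelCoupling.exists_aeEqSquare_pullback [IsProbabilityMeasure γ] {W W' : SymmKernel}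
    (h : KernelCoupling γ X Y W W') :
    ∃ (U : SymmKernel) (φ ψ : I → I), LebesguePreserving φ ∧ LebesguePreserving ψ ∧
      AEEqSquare W (pullback U φ) ∧ AEEqSquare W' (pullback U ψ) := by
  obtain ⟨V, measurable_V, -, hV⟩ := W.exists_borel W.bounded'.choose_spec
  obtain ⟨V', measurable_V', -, hV'⟩ := W'.exists_borel W'.bounded'.choose_spec
  obtain ⟨ν, φ, ψ, U, hφ, hψ, measurable_U, hU, hU'⟩ :=
    (h.congr_kernels hV hV').exists_common_factor measurable_V measurable_V'
  have : IsProbabilityMeasure ν := hφ.map_eq ▸ Measure.isProbabilityMeasure_map hφ.aemeasurable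
  obtain ⟨ρ, hρ, quantile_ρ⟩ := exists_measurePreserving_ae_quantile_eq hφ
  obtain ⟨τ, hτ, quantile_τ⟩ := exists_measurePreserving_ae_quantile_eq hψ
  refine ⟨⟨pullback U (quantile ν), fun _ _ => U.symm' _ _, ?_, ?_⟩, ρ, τ,
    lebesguePreserving_of_measurePreserving hρ, lebesguePreserving_of_measurePreserving hτ, ?_, ?_⟩
  · exact U.bounded'.imp fun C hC x y => hC _ _
  · exact (measurable_U.comp
      (measurable_quantile.prodMap measurable_quantile)).nullMeasurable
  · exact hV.trans (hU.trans (aeEqSquare_pullback_quantile U quantile_ρ))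
  · exact hV'.trans (hU'.trans (aeEqSquare_pullback_quantile U quantile_τ))

theorem KernelCoupling.exists_aeEqSquare_pullback_pullback {γ : Measure (I × I)}
    [IsProbabilityMeasure γ] (h : KernelCoupling γ Prod.fst Prod.snd W W') :
    ∃ φ ψ : I → I, LebesguePreserving φ ∧ LebesguePreserving ψ ∧
      AEEqSquare (pullback W' φ) (pullback W ψ) := by
  obtain ⟨ρ, measurable_ρ, hρ⟩ := γ.exists_measurable_map_eq
  have pulled_back := h.comp ⟨measurable_ρ, hρ⟩
  exact ⟨_, _, lebesguePreserving_of_measurePreserving pulled_back.right,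
    lebesguePreserving_of_measurePreserving pulled_back.left,
    pulled_back.ae_eq.mono fun _ => Eq.symm⟩

end CommonFactor

theorem multiDensity_eq_of_aeEqSquare_pullback {W U : SymmKernel} {φ : I → I}
    (hφ : LebesguePreserving φ) (h : AEEqSquare W (pullback U φ)) {V : Type} [Fintype V]
    (F : Multigraph V) : multiDensity F W = multiDensity F U := by
  obtain ⟨ρ, τ, coupling⟩ := KernelCoupling.of_aeEqSquare_pullback
    (lebesguePreserving_of_measurePreserving (.id volume)) hφ h
  exact coupling.multiDensity_eq F

theorem corollary2 (W W' : SymmKernel) :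
    List.TFAE [
      ∀ (n : ℕ) (F : SimpleGraph (Fin n)), simpleDensity F W' = simpleDensity F W,
      ∀ (n : ℕ) (F : Multigraph (Fin n)), multiDensity F W' = multiDensity F W,
      ∃ (U : SymmKernel) (φ ψ : I → I), LebesguePreserving φ ∧ LebesguePreserving ψ ∧
        AEEqSquare W (pullback U φ) ∧ AEEqSquare W' (pullback U ψ),
      ∃ φ ψ : I → I, LebesguePreserving φ ∧ LebesguePreserving ψ ∧
        AEEqSquare (pullback W' φ) (pullback W ψ),
      ∃ γ : Measure (I × I), IsProbabilityMeasure γ ∧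
        γ.map Prod.fst = (volume : Measure I) ∧ γ.map Prod.snd = (volume : Measure I) ∧
        ∀ᵐ p ∂(γ.prod γ), W p.1.1 p.2.1 = W' p.1.2 p.2.2] := by
  tfae_have 1 → 5 := fun h => by
    obtain ⟨γ, hγ⟩ := exists_kernelCoupling_of_simpleDensity_eq h
    exact ⟨γ, inferInstance, hγ.left.map_eq, hγ.right.map_eq, hγ.ae_eq⟩
  tfae_have 5 → 3 := fun ⟨γ, _, hfst, hsnd, h⟩ =>
    KernelCoupling.exists_aeEqSquare_pullback (γ := γ)
      ⟨⟨measurable_fst, hfst⟩, ⟨measurable_snd, hsnd⟩, h⟩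
  tfae_have 5 → 4 := fun ⟨γ, _, hfst, hsnd, h⟩ =>
    KernelCoupling.exists_aeEqSquare_pullback_pullback (γ := γ)
      ⟨⟨measurable_fst, hfst⟩, ⟨measurable_snd, hsnd⟩, h⟩
  tfae_have 3 → 2 := fun ⟨U, φ, ψ, hφ, hψ, hW, hW'⟩ n F =>
    (multiDensity_eq_of_aeEqSquare_pullback hψ hW' F).trans
      (multiDensity_eq_of_aeEqSquare_pullback hφ hW F).symm
  tfae_have 4 → 2 := fun ⟨φ, ψ, hφ, hψ, h⟩ n F => by
    obtain ⟨φ', ψ', coupling⟩ := KernelCoupling.of_aeEqSquare_pullback hφ hψ h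
    exact coupling.multiDensity_eq F
  tfae_have 2 → 1 := fun h n F => by
    simpa only [multiDensity_ofSimpleGraph] using h n (.ofSimpleGraph F)
  tfae_finish
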